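/- Let $\mathcal H,\mathcal G$ be real Hilbert spaces. Let $A:\mathcal H\to 2^{\mathcal H}$ be maximally $\rho$-monotone for some $\rho\in\mathbb R$ (i.e. $\langle x-y\mid u-v\rangle\ge\rho\|x-y\|^2$ for all $u\in Ax$, $v\in Ay$, and the graph of $A$ is maximal among the graphs of operators with this property), let $C:\mathcal H\to\mathcal H$ be $\beta$-cocoercive with $\beta>0$ (i.e. $\langle x-y\mid Cx-Cy\rangle\ge\beta\|Cx-Cy\|^2$ for all $x,y$), let $B:\mathcal G\to\mathcal G$ be monotone and $\zeta$-Lipschitzian with $\zeta>0$, let $L:\mathcal H\to\mathcal G$ and $K:\mathcal G\to\mathcal H$ be bounded linear operators, let $c\in\mathcal G$ and $\alpha\ge 0$. For a bounded linear $M:\mathcal G\to\mathcal H$ set $D_Mx=\alpha M(Lx-c)+MBLx$, and write $\operatorname{Lip}T$ for the smallest Lipschitz constant of $T$. Put $$\kappa_K=\operatorname{Lip}\big(K(\alpha\,\mathrm{Id}+B)L\big),\qquad \lambda_{\min}=\inf_{\|x\|=1}\langle x\mid KLx\rangle,\qquad \hat\rho=\rho+\alpha\lambda_{\min}-\operatorname{Lip}\big((L^*-K)BL\big).$$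 Assume that the set $\mathrm{zer}(A+C+D_K)$ of solutions $x$ of $$0\in Ax+Cx+\alpha K(Lx-c)+KBLx$$ is nonempty, that $D_K$ is not identically zero, that $\hat\rho\ge 0$, and that $(K_n)_{n\in\mathbb N}$ are bounded linear operators from $\mathcal G$ to $\mathcal H$ with $\|K_n-K\|\le\omega_n$ for all $n$, where $\omega_n\ge 0$ and $\sum_n\omega_n<+\infty$. Let $\gamma>0$ satisfy $\kappa_K^2\gamma^2\big(1+\frac{\gamma}{2\beta}\big)<1$ and $\rho\gamma>-1$. Then the resolvents $J_{\gamma A}=(\mathrm{Id}+\gamma A)^{-1}$ and $J_{\gamma C}=(\mathrm{Id}+\gamma C)^{-1}$ are single-valued and defined on all of $\mathcal H$. Define $$R^\gamma=J_{\gamma A}\big(2J_{\gamma C}-\mathrm{Id}-\gamma D_KJ_{\gamma C}\big),\qquad V^\gamma=(\mathrm{Id}-\gamma D_K)R^\gamma+\mathrm{Id}-(\mathrm{Id}-\gamma D_K)J_{\gamma C},$$ and, from an arbitrary $z_0\in\mathcal H$, define for all $n\in\mathbb N$ $$x_n=J_{\gamma C}z_n,\quad w_n=D_{K_n}x_n,\quad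 y_n=J_{\gamma A}(2x_n-z_n-\gamma w_n),\quad z_{n+1}=z_n+y_n-x_n-\gamma(D_{K_n}y_n-w_n).$$ Then there is $\bar z\in\mathrm{Fix}\,V^\gamma$ such that: 1. $(z_n)$ converges weakly to $\bar z$, and $(x_n)$ converges weakly to $J_{\gamma C}\bar z\in\mathrm{zer}(A+C+D_K)$. 2. If $\hat\rho>0$ and there is $\bar\eta\in[0,1[$ with $\omega_n=\omega_0\bar\eta^n$ for all $n$, then $(z_n)$ converges linearly to $\bar z$, $(x_n)$ converges linearly to $J_{\gamma C}\bar z$, and $J_{\gamma C}\bar z$ is the unique solution of the inclusion. Here $(a_n)$ converges linearly to $a$ if there are $M\ge 0$ and $q\in\,]0,1[$ with $\|a_n-a\|\le Mq^n$ for all $n$. -/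

import Mathlib

open Filter Topology

namespace FDRF

noncomputable section

/-! ### Set-valued and single-valued operators on a real Hilbert space -/

section Operators

variable {E F : Type*} [NormedAddCommGroup E] [InnerProductSpace ℝ E]
  [NormedAddCommGroup F] [InnerProductSpace ℝ F]

/-- A set-valued operator `A` is `ρ`-monotone. -/
def IsRhoMonotone (ρ : ℝ) (A : E → Set E) : Prop :=
  ∀ x y : E, ∀ u ∈ A x, ∀ v ∈ A y, ρ * ‖x - y‖ ^ 2 ≤ inner ℝ (x - y) (u - v)

/-- `A` is maximally `ρ`-monotone: no `ρ`-monotone operator has a strictly larger graph. -/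
def IsMaximallyRhoMonotone (ρ : ℝ) (A : E → Set E) : Prop :=
  IsRhoMonotone ρ A ∧
    ∀ A' : E → Set E, IsRhoMonotone ρ A' → (∀ x, A x ⊆ A' x) → ∀ x, A' x ⊆ A x

/-- A single-valued, everywhere defined operator is monotone. -/
def IsMonotone (T : E → E) : Prop :=
  ∀ x y : E, 0 ≤ inner ℝ (x - y) (T x - T y)

/-- `T` is `β`-cocoercive. -/
def IsCocoercive (β : ℝ) (T : E → E) : Prop :=
  ∀ x y : E, β * ‖T x - T y‖ ^ 2 ≤ inner ℝ (x - y) (T x - T y)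

/-- `T` is `β`-Lipschitzian. -/
def IsLipschitzian (β : ℝ) (T : E → F) : Prop :=
  ∀ x y : E, ‖T x - T y‖ ≤ β * ‖x - y‖

/-- The Lipschitz constant of `T`: the smallest `β ≥ 0` for which `T` is `β`-Lipschitzian
(it is only used for operators that are Lipschitzian). -/
def lip (T : E → F) : ℝ := sInf {β : ℝ | 0 ≤ β ∧ IsLipschitzian β T}

/-- The zeros of a set-valued operator. -/
def zer (A : E → Set E) : Set E := {x | (0 : E) ∈ A x}

/-- The set-valued operator `x ↦ {T x}`. -/
def single (T : E → E) : E → Set E := fun x => {T x}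

/-- The set-valued operator `γ A`. -/
def scale (γ : ℝ) (A : E → Set E) : E → Set E := fun x => (fun u => γ • u) '' A x

/-- The set-valued operator `A + T`, for `T` single-valued. -/
def addSingle (A : E → Set E) (T : E → E) : E → Set E := fun x => (fun u => u + T x) '' A x

/-- The set-valued resolvent `(Id + A)⁻¹`. -/
def resolventValues (A : E → Set E) (u : E) : Set E := {p | ∃ v ∈ A p, p + v = u}

/-- The resolvent `J_A` as a map: the point of `(Id + A)⁻¹ u`. -/
def J (A : E → Set E) (u : E) : E := Classical.epsilon fun p => p ∈ resolventValues A u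

/-- Weak convergence of a sequence. -/
def ConvergesWeakly (z : ℕ → E) (a : E) : Prop :=
  Tendsto (fun n => toWeakSpace ℝ E (z n)) atTop (𝓝 (toWeakSpace ℝ E a))

/-- Linear (that is, geometric) convergence of a sequence. -/
def ConvergesLinearly (z : ℕ → E) (a : E) : Prop :=
  ∃ M q : ℝ, 0 < q ∧ q < 1 ∧ ∀ n : ℕ, ‖z n - a‖ ≤ M * q ^ n

end Operators

/-! ### The mismatched inclusion and the algorithm -/

section Problem

variable {H G : Type*} [NormedAddCommGroup H] [InnerProductSpace ℝ H]
  [NormedAddCommGroup G] [InnerProductSpace ℝ G]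

/-- `D_M x = α M (L x - c) + M B L x`. -/
def D (B : G → G) (L : H →L[ℝ] G) (c : G) (α : ℝ) (M : G →L[ℝ] H) (x : H) : H :=
  α • M (L x - c) + M (B (L x))

/-- `κ_M = Lip (M (α Id + B) L)`. -/
def kappa (B : G → G) (L : H →L[ℝ] G) (α : ℝ) (M : G →L[ℝ] H) : ℝ :=
  lip fun x : H => M (α • L x + B (L x))

/-- `ζ̃_M = Lip (M B L)`. -/
def zetaTilde (B : G → G) (L : H →L[ℝ] G) (M : G →L[ℝ] H) : ℝ :=
  lip fun x : H => M (B (L x))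

/-- `λ_min = inf {⟨x, K L x⟩ : ‖x‖ = 1}`. -/
def lambdaMin (L : H →L[ℝ] G) (K : G →L[ℝ] H) : ℝ :=
  sInf {r : ℝ | ∃ x : H, ‖x‖ = 1 ∧ r = inner ℝ x (K (L x))}

/-- `ρ̂ = ρ + α λ_min - ζ̃_{L* - K}`. -/
def rhoHat [CompleteSpace H] [CompleteSpace G]
    (ρ : ℝ) (B : G → G) (L : H →L[ℝ] G) (K : G →L[ℝ] H) (α : ℝ) : ℝ :=
  ρ + α * lambdaMin L K - zetaTilde B L (ContinuousLinearMap.adjoint L - K)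

/-- The set-valued operator `A + C + D_K`; its zeros are the solutions of the inclusion
`0 ∈ A x + C x + α K (L x - c) + K B L x`. -/
def problemOp (A : H → Set H) (C : H → H) (B : G → G) (L : H →L[ℝ] G) (K : G →L[ℝ] H)
    (c : G) (α : ℝ) : H → Set H :=
  addSingle (addSingle A C) (D B L c α K)

/-- The set `Γ` of admissible step sizes. -/
def Gam (ρ β : ℝ) (B : G → G) (L : H →L[ℝ] G) (K : G →L[ℝ] H) (α : ℝ) : Set ℝ :=
  {γ | 0 < γ ∧ kappa B L α K ^ 2 * γ ^ 2 * (1 + γ / (2 * β)) < 1 ∧ -1 < ρ * γ}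

/-- `R^γ = J_{γA} (2 J_{γC} - Id - γ D_K J_{γC})`. -/
def R (A : H → Set H) (C : H → H) (B : G → G) (L : H →L[ℝ] G) (K : G →L[ℝ] H)
    (c : G) (α γ : ℝ) (z : H) : H :=
  J (scale γ A) ((2 : ℝ) • J (scale γ (single C)) z - z
    - γ • D B L c α K (J (scale γ (single C)) z))

/-- `V^γ = (Id - γ D_K) R^γ + Id - (Id - γ D_K) J_{γC}`. -/
def V (A : H → Set H) (C : H → H) (B : G → G) (L : H →L[ℝ] G) (K : G →L[ℝ] H)
    (c : G) (α γ : ℝ) (z : H) : H :=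
  (R A C B L K c α γ z - γ • D B L c α K (R A C B L K c α γ z)) + z
    - (J (scale γ (single C)) z - γ • D B L c α K (J (scale γ (single C)) z))

/-- The sequences `x, w, y, z` are generated by the mismatched
forward-Douglas–Rachford-forward iteration with step size `γ`, the approximation `Kn n` of `K`
being used at step `n`. -/
structure IsIteration (A : H → Set H) (C : H → H) (B : G → G) (L : H →L[ℝ] G)
    (Kn : ℕ → G →L[ℝ] H) (c : G) (α γ : ℝ) (x w y z : ℕ → H) : Prop where
  x_eq : ∀ n, x n = J (scale γ (single C)) (z n)
  w_eq : ∀ n, w n = D B L c α (Kn n) (x n)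
  y_eq : ∀ n, y n = J (scale γ A) ((2 : ℝ) • x n - z n - γ • w n)
  z_eq : ∀ n, z (n + 1) = z n + y n - x n - γ • (D B L c α (Kn n) (y n) - w n)

end Problem

end

end FDRF

/-! Write T for `D B L c α K`, x = J_{γC} z, and y for the midpoint R^γ z. Since x + γCx = z, one
exact step satisfies y + γa = x - γCx - γTx with a ∈ Ay. The new point y - γTy + z - x + γTx is V^γ
z. The operator A + T is ρ̂-monotone even though A alone may have ρ < 0: K is split as L* - (L* -
K), the adjoint part inherits the monotonicity of B, and the mismatch costs at most its Lipschitz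
constant. Combining this with the cocoercivity of C and completing a square gives a Fejér inequality
(`norm_step_sub_sq_le`) whose decrease controls ‖x - y‖², ρ̂‖y - x̄‖² and the variation of C, where
x̄ is a solution. The step size condition is exactly positivity of the coefficient of ‖x - y‖².

Replacing K by K_n changes the step by at most ω_n times an affine function of the distance to a
reference point. A discrete Grönwall argument bounds the iterates, so the errors are summable and
the scheme is quasi-Fejér. Hence x_n - y_n → 0 and C x_n converges strongly. Weak cluster points are
then fixed points (`weakLim_spec`), and Opial's argument gives a single weak limit. If ρ̂ > 0, the
Fejér inequality is a contraction towards solutions, and geometric errors give a geometric rate.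

Maximality of A serves only to make its resolvent everywhere defined (Minty's theorem, derived here
from a finite minimax argument and weak compactness). -/

namespace FDRF

/-! ### Everywhere defined resolvents: Minty's theorem and the cocoercive case. -/

section Minty

variable {E : Type*} [NormedAddCommGroup E] [InnerProductSpace ℝ E]

/-- If every convex combination of the quadratics `‖x‖² - 2⟪x, c i⟫ + d i` has a nonpositive
minimum, then some point makes all of them nonpositive. -/
theorem exists_forall_quadratic_nonpos {ι : Type*} [Fintype ι] [Nonempty ι] (c : ι → E)
    (d : ι → ℝ)
    (h : ∀ l ∈ stdSimplex ℝ ι, ∑ i, l i * d i ≤ ‖∑ i, l i • c i‖ ^ 2) :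
    ∃ x : E, ∀ i, ‖x‖ ^ 2 - 2 * inner ℝ x (c i) + d i ≤ 0 := by
  classical
  -- Maximise the dual function, the minimum over x of the l-combination. The optimality condition
  -- towards the vertex `i`, added to `hSX`, is the claim for the minimiser X.
  obtain ⟨l, hl, hmax⟩ := (isCompact_stdSimplex ℝ ι).exists_isMaxOn
    (⟨_, single_mem_stdSimplex ℝ (Classical.arbitrary ι)⟩ : (stdSimplex ℝ ι).Nonempty)
    (f := fun l : ι → ℝ => ∑ i, l i * d i - ‖∑ i, l i • c i‖ ^ 2)
    (by fun_prop)
  set X : E := ∑ i, l i • c i with hX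
  set S : ℝ := ∑ i, l i * d i with hS
  have hSX : S ≤ ‖X‖ ^ 2 := h l hl
  refine ⟨X, fun i => ?_⟩
  have key : ∀ t : ℝ, 0 < t → t ≤ 1 →
      d i - S - 2 * inner ℝ X (c i) + 2 * ‖X‖ ^ 2 ≤ t * ‖c i - X‖ ^ 2 := by
    intro t ht0 ht1
    have hmem : (1 - t) • l + t • (Pi.single i (1 : ℝ) : ι → ℝ) ∈ stdSimplex ℝ ι :=
      convex_stdSimplex ℝ ι hl (single_mem_stdSimplex ℝ i) (by linarith) ht0.le (by ring)
    have h1 : ∑ j, ((1 - t) • l + t • (Pi.single i (1 : ℝ) : ι → ℝ)) j * d j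
        = (1 - t) * S + t * d i := by
      simp [add_mul, Finset.sum_add_distrib, hS, Finset.mul_sum, mul_assoc, Pi.single_apply]
    have h2 : ∑ j, ((1 - t) • l + t • (Pi.single i (1 : ℝ) : ι → ℝ)) j • c j
        = X + t • (c i - X) := by
      have : X + t • (c i - X) = (1 - t) • X + t • c i := by module
      rw [this]
      simp [add_smul, Finset.sum_add_distrib, hX, Finset.smul_sum, mul_smul, Pi.single_apply]
    have h3 := hmax hmem
    simp only [Set.mem_ofPred_eq] at h3
    rw [h1, h2, norm_add_sq_real, real_inner_smul_right, norm_smul, inner_sub_right,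
      real_inner_self_eq_norm_sq, Real.norm_eq_abs, abs_of_pos ht0] at h3
    have h4 : t * (d i - S - 2 * inner ℝ X (c i) + 2 * ‖X‖ ^ 2) ≤ t * (t * ‖c i - X‖ ^ 2) := by
      nlinarith
    exact le_of_mul_le_mul_left h4 ht0
  have hlim : Tendsto (fun t : ℝ => t * ‖c i - X‖ ^ 2) (𝓝[>] 0) (𝓝 0) := by
    have : Tendsto (fun t : ℝ => t * ‖c i - X‖ ^ 2) (𝓝 0) (𝓝 (0 * ‖c i - X‖ ^ 2)) :=
      tendsto_id.mul_const _
    rw [zero_mul] at this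
    exact this.mono_left nhdsWithin_le_nhds
  have h0 : d i - S - 2 * inner ℝ X (c i) + 2 * ‖X‖ ^ 2 ≤ 0 := by
    refine ge_of_tendsto hlim ?_
    filter_upwards [Ioc_mem_nhdsGT (zero_lt_one' ℝ)] with t ht using key t ht.1 ht.2
  linarith

/-- Chebyshev's inequality for a finite monotone family. -/
theorem inner_sum_le_sum_inner_of_monotone {ι : Type*} [Fintype ι] (y v : ι → E)
    (h : ∀ i j, 0 ≤ inner ℝ (y i - y j) (v i - v j)) {l : ι → ℝ} (hl : l ∈ stdSimplex ℝ ι) :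
    inner ℝ (∑ i, l i • y i) (∑ i, l i • v i) ≤ ∑ i, l i * inner ℝ (y i) (v i) := by
  have h0 : 0 ≤ ∑ i, ∑ j, l i * l j * inner ℝ (y i - y j) (v i - v j) :=
    Finset.sum_nonneg fun i _ => Finset.sum_nonneg fun j _ =>
      mul_nonneg (mul_nonneg (hl.1 i) (hl.1 j)) (h i j)
  have h1 : ∑ i, ∑ j, l i * l j * inner ℝ (y i) (v i) = ∑ i, l i * inner ℝ (y i) (v i) := by
    refine Finset.sum_congr rfl fun i _ => ?_
    calc ∑ j, l i * l j * inner ℝ (y i) (v i)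
        = (∑ j, l j) * (l i * inner ℝ (y i) (v i)) := by
          rw [Finset.sum_mul]; exact Finset.sum_congr rfl fun j _ => by ring
      _ = _ := by rw [hl.2, one_mul]
  have h2 : ∑ i, ∑ j, l i * l j * inner ℝ (y j) (v j) = ∑ i, l i * inner ℝ (y i) (v i) := by
    rw [Finset.sum_comm, ← h1]
    exact Finset.sum_congr rfl fun i _ => Finset.sum_congr rfl fun j _ => by ring
  have h3 : ∑ i, ∑ j, l i * l j * inner ℝ (y i) (v j)
      = inner ℝ (∑ i, l i • y i) (∑ i, l i • v i) := by
    rw [Finset.sum_comm]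
    simp only [sum_inner, inner_sum, real_inner_smul_left, real_inner_smul_right]
    exact Finset.sum_congr rfl fun i _ => Finset.sum_congr rfl fun j _ => by ring
  have h4 : ∑ i, ∑ j, l i * l j * inner ℝ (y j) (v i)
      = inner ℝ (∑ i, l i • y i) (∑ i, l i • v i) := by
    rw [Finset.sum_comm, ← h3]
    exact Finset.sum_congr rfl fun i _ => Finset.sum_congr rfl fun j _ => by ring
  simp only [inner_sub_left, inner_sub_right, mul_sub, Finset.sum_sub_distrib, h1, h2, h3, h4]
    at h0
  linarith

/-- The quadratic is ⟪x - y i, x + v i⟫, so (x, -x) is monotonically related to each (y i, v i).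
After Chebyshev's inequality, the dual condition reduces to ‖Y + V‖² ≥ 0 for the averages Y, V. -/
theorem exists_monotonically_related_of_fintype {ι : Type*} [Fintype ι] (y v : ι → E)
    (h : ∀ i j, 0 ≤ inner ℝ (y i - y j) (v i - v j)) :
    ∃ x : E, ∀ i, ‖x‖ ^ 2 - inner ℝ x (y i - v i) - inner ℝ (y i) (v i) ≤ 0 := by
  cases isEmpty_or_nonempty ι with
  | inl _ => exact ⟨0, fun i => isEmptyElim i⟩
  | inr _ =>
    obtain ⟨x, hx⟩ := exists_forall_quadratic_nonpos
      (fun i => (1 / 2 : ℝ) • (y i - v i)) (fun i => -inner ℝ (y i) (v i)) (by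
        intro l hl
        have h1 := inner_sum_le_sum_inner_of_monotone y v h hl
        have h2 : ∑ i, l i • (1 / 2 : ℝ) • (y i - v i)
            = (1 / 2 : ℝ) • (∑ i, l i • y i - ∑ i, l i • v i) := by
          rw [← Finset.sum_sub_distrib, Finset.smul_sum]
          exact Finset.sum_congr rfl fun i _ => by module
        rw [h2, norm_smul, mul_pow, norm_sub_sq_real]
        have h3 := norm_add_sq_real (∑ i, l i • y i) (∑ i, l i • v i)
        have h4 := sq_nonneg ‖∑ i, l i • y i + ∑ i, l i • v i‖
        simp only [mul_neg, Finset.sum_neg_distrib]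
        norm_num
        linarith)
    refine ⟨x, fun i => ?_⟩
    have := hx i
    rw [real_inner_smul_right] at this
    linarith

/-- A bounded family has a weak limit along every ultrafilter. -/
theorem exists_weak_limit [CompleteSpace E] {ι : Type*} (U : Ultrafilter ι) (z : ι → E) (C : ℝ)
    (h : ∀ᶠ n in U, ‖z n‖ ≤ C) :
    ∃ a : E, ∀ v, Tendsto (fun n => inner ℝ (z n) v) U (𝓝 (inner ℝ a v)) := by
  have hb : ∀ v : E, ∀ᶠ n in U, ‖inner ℝ (z n) v‖ ≤ C * ‖v‖ := fun v => by
    filter_upwards [h] with n hn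
    exact (norm_inner_le_norm _ _).trans (mul_le_mul_of_nonneg_right hn (norm_nonneg _))
  have hex : ∀ v : E, ∃ r : ℝ, ‖r‖ ≤ C * ‖v‖ ∧
      Tendsto (fun n => inner ℝ (z n) v) U (𝓝 r) := fun v => by
    obtain ⟨r, hr, hlim⟩ := (isCompact_closedBall (0 : ℝ) (C * ‖v‖)).ultrafilter_le_nhds
      (U.map fun n => inner ℝ (z n) v) (by
        rw [le_principal_iff]
        refine (hb v).mono fun n hn => ?_
        simpa using hn)
    exact ⟨r, by simpa using hr, hlim⟩
  choose f hf hlim using hex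
  let F : E →ₗ[ℝ] ℝ :=
    { toFun := f
      map_add' := fun u v => tendsto_nhds_unique (hlim (u + v)) (by
        simpa only [inner_add_right] using (hlim u).add (hlim v))
      map_smul' := fun r v => tendsto_nhds_unique (hlim (r • v)) (by
        simpa only [real_inner_smul_right, RingHom.id_apply, smul_eq_mul]
          using (hlim v).const_mul r) }
  refine ⟨(InnerProductSpace.toDual ℝ E).symm (F.mkContinuous C hf), fun v => ?_⟩
  rw [InnerProductSpace.toDual_symm_apply]
  exact hlim v

/-- A point of a monotone graph can be added over every value of `Id + M`. -/
theorem exists_monotonically_related [CompleteSpace E] (M : Set (E × E))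
    (hM : ∀ p ∈ M, ∀ q ∈ M, 0 ≤ inner ℝ (p.1 - q.1) (p.2 - q.2)) (u : E) :
    ∃ x : E, ∀ p ∈ M, 0 ≤ inner ℝ (x - p.1) (u - x - p.2) := by
  rcases M.eq_empty_or_nonempty with rfl | ⟨p₀, hp₀⟩
  · exact ⟨0, by simp⟩
  have hfin : ∀ F : Finset M, ∃ x : E, ∀ p ∈ F,
      ‖x‖ ^ 2 - inner ℝ x (p.1.1 - (p.1.2 - u)) - inner ℝ p.1.1 (p.1.2 - u) ≤ 0 := by
    intro F
    obtain ⟨x, hx⟩ := exists_monotonically_related_of_fintype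
      (fun p : F => p.1.1.1) (fun p : F => p.1.1.2 - u) (fun p q => by
        simpa using hM _ p.1.2 _ q.1.2)
    exact ⟨x, fun p hp => hx ⟨p, hp⟩⟩
  choose X hX using hfin
  -- Along an ultrafilter finer than the directed order on finite subsets, each constraint
  -- eventually holds, and the constraint at `p₀` alone bounds `X F`.
  let U : Ultrafilter (Finset M) := Ultrafilter.of atTop
  have hU : ∀ p : M, ∀ᶠ F in U, ‖X F‖ ^ 2 - inner ℝ (X F) (p.1.1 - (p.1.2 - u))
      - inner ℝ p.1.1 (p.1.2 - u) ≤ 0 := fun p => by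
    refine Ultrafilter.of_le _ ?_
    filter_upwards [eventually_ge_atTop {p}] with F hF
    exact hX F p (hF (Finset.mem_singleton_self p))
  obtain ⟨x, hx⟩ := exists_weak_limit U X
    (‖p₀.1 - (p₀.2 - u)‖ + |inner ℝ p₀.1 (p₀.2 - u)| + 1) (by
      filter_upwards [hU ⟨p₀, hp₀⟩] with F hF
      have h1 := real_inner_le_norm (X F) (p₀.1 - (p₀.2 - u))
      have h2 := le_abs_self (inner ℝ p₀.1 (p₀.2 - u))
      have h3 := abs_nonneg (inner ℝ p₀.1 (p₀.2 - u))
      have h4 := norm_nonneg (X F)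
      have h5 := norm_nonneg (p₀.1 - (p₀.2 - u))
      by_contra! hcon
      nlinarith)
  refine ⟨x, fun p hp => ?_⟩
  -- Weak lower semicontinuity by hand: ‖X F‖² is replaced by its minorant 2⟪X F, x⟫ - ‖x‖², which
  -- passes to the weak limit.
  have hle : 2 * inner ℝ x x - ‖x‖ ^ 2 - inner ℝ x (p.1 - (p.2 - u))
      - inner ℝ p.1 (p.2 - u) ≤ 0 := by
    refine le_of_tendsto (((((hx x).const_mul 2).sub_const (‖x‖ ^ 2)).sub
      (hx (p.1 - (p.2 - u)))).sub_const (inner ℝ p.1 (p.2 - u))) ?_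
    filter_upwards [hU ⟨p, hp⟩] with F hF
    have h1 := norm_sub_sq_real (X F) x
    have h2 := sq_nonneg ‖X F - x‖
    linarith
  have e : inner ℝ (x - p.1) (u - x - p.2)
      = -(inner ℝ x x - inner ℝ x (p.1 - (p.2 - u)) - inner ℝ p.1 (p.2 - u)) := by
    simp only [inner_sub_left, inner_sub_right]
    rw [real_inner_comm p.1 x]
    ring
  rw [e]
  rw [real_inner_self_eq_norm_sq] at hle ⊢
  linarith

/-- Minty's theorem: the resolvent of a maximally `ρ`-monotone operator is defined everywhere. -/
theorem IsMaximallyRhoMonotone.exists_mem_resolventValues [CompleteSpace E] {ρ γ : ℝ}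
    {A : E → Set E} (hA : IsMaximallyRhoMonotone ρ A) (hγ : 0 < γ) (hργ : -1 < ρ * γ) (u : E) :
    ∃ p v, v ∈ A p ∧ p + γ • v = u := by
  have hs : 0 < 1 + ρ * γ := by linarith
  set s := 1 + ρ * γ with hsdef
  -- Id + γA = s (Id + (γ/s)(A - ρ Id)), and A - ρ Id is monotone; hence the operator used and the
  -- target u/s.
  obtain ⟨x, hx⟩ := exists_monotonically_related
    {p : E × E | ∃ a ∈ A p.1, p.2 = (γ / s) • (a - ρ • p.1)} (by
      rintro ⟨x, x'⟩ ⟨a, ha, hx'⟩ ⟨y, y'⟩ ⟨b, hb, hy'⟩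
      have h := hA.1 x y a ha b hb
      have e : (γ / s) • (a - ρ • x) - (γ / s) • (b - ρ • y)
          = (γ / s) • ((a - b) - ρ • (x - y)) := by module
      simp only at ha hb hx' hy' ⊢
      rw [hx', hy', e, real_inner_smul_right, inner_sub_right, real_inner_smul_right,
        real_inner_self_eq_norm_sq]
      exact mul_nonneg (div_pos hγ hs).le (by linarith)) (s⁻¹ • u)
  -- the new graph point
  set v : E := γ⁻¹ • (u - x) with hv
  have hrel : ∀ y, ∀ b ∈ A y, ρ * ‖x - y‖ ^ 2 ≤ inner ℝ (x - y) (v - b) := by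
    intro y b hb
    have h := hx (y, (γ / s) • (b - ρ • y)) ⟨b, hb, rfl⟩
    have e : s⁻¹ • u - x - (γ / s) • (b - ρ • y) = (γ / s) • ((v - b) - ρ • (x - y)) := by
      have hx' : x = s⁻¹ • (x + (ρ * γ) • x) := by
        rw [eq_inv_smul_iff₀ hs.ne', hsdef]; module
      rw [hv]
      calc s⁻¹ • u - x - (γ / s) • (b - ρ • y)
          = s⁻¹ • u - s⁻¹ • (x + (ρ * γ) • x) - (γ / s) • (b - ρ • y) := by rw [← hx']
        _ = _ := by
          match_scalars <;> field_simp; ring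
    simp only at h
    rw [e, real_inner_smul_right, inner_sub_right, real_inner_smul_right,
        real_inner_self_eq_norm_sq] at h
    have := nonneg_of_mul_nonneg_right h (div_pos hγ hs)
    linarith
  have hmem : v ∈ A x := by
    refine hA.2 (fun y => A y ∪ {b | y = x ∧ b = v}) ?_ (fun y => Set.subset_union_left) x
      (Or.inr ⟨rfl, rfl⟩)
    rintro y₁ y₂ b₁ (h₁ | ⟨rfl, rfl⟩) b₂ (h₂ | ⟨rfl, rfl⟩)
    · exact hA.1 _ _ _ h₁ _ h₂
    · have := hrel _ _ h₁
      rwa [norm_sub_rev, ← neg_sub y₁, ← neg_sub b₁, inner_neg_neg] at this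
    · exact hrel _ _ h₂
    · simp
  refine ⟨x, v, hmem, ?_⟩
  rw [hv, smul_inv_smul₀ hγ.ne']
  abel

theorem IsRhoMonotone.norm_sub_le_of_add_smul {ρ γ : ℝ} {A : E → Set E}
    (hA : IsRhoMonotone ρ A) (hγ : 0 < γ) {p q a b : E} (ha : a ∈ A p) (hb : b ∈ A q) :
    (1 + ρ * γ) * ‖p - q‖ ≤ ‖(p + γ • a) - (q + γ • b)‖ := by
  have h := hA p q a ha b hb
  have e : (p + γ • a) - (q + γ • b) = (p - q) + γ • (a - b) := by module
  have h1 := real_inner_le_norm (p - q) ((p + γ • a) - (q + γ • b))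
  rcases (norm_nonneg (p - q)).eq_or_lt with h0 | h0
  · rw [← h0]; simp
  · rw [e, inner_add_right, real_inner_smul_right, real_inner_self_eq_norm_sq] at h1
    rw [e]
    refine le_of_mul_le_mul_left ?_ h0
    nlinarith

theorem IsCocoercive.norm_sub_le {β : ℝ} {C : E → E} (hC : IsCocoercive β C) (x y : E) :
    β * ‖C x - C y‖ ≤ ‖x - y‖ := by
  have h := hC x y
  have h1 := real_inner_le_norm (x - y) (C x - C y)
  rcases (norm_nonneg (C x - C y)).eq_or_lt with h0 | h0
  · rw [← h0]; simp
  · refine le_of_mul_le_mul_right ?_ h0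
    nlinarith

theorem IsCocoercive.isRhoMonotone_single {β : ℝ} (hβ : 0 ≤ β) {C : E → E}
    (hC : IsCocoercive β C) : IsRhoMonotone 0 (single C) := by
  rintro x y u rfl v rfl
  rw [zero_mul]
  exact (mul_nonneg hβ (sq_nonneg _)).trans (hC x y)

/-- Cocoercivity makes N = Id - 2βC nonexpansive, and p + γCp = u reads (2β + γ)p = 2βu + γNp. This
is a fixed point equation for a contraction of ratio γ/(2β + γ), so Banach's theorem applies. -/
theorem IsCocoercive.exists_add_smul_eq [CompleteSpace E] {β γ : ℝ} {C : E → E} (hβ : 0 < β)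
    (hC : IsCocoercive β C) (hγ : 0 < γ) (u : E) : ∃ p, p + γ • C p = u := by
  -- fixed point of `p ↦ (2β + γ)⁻¹ (2β u + γ (p - 2β C p))`
  have hN : ∀ x y : E, ‖(x - (2 * β) • C x) - (y - (2 * β) • C y)‖ ≤ ‖x - y‖ := by
    intro x y
    have e : (x - (2 * β) • C x) - (y - (2 * β) • C y)
        = (x - y) - (2 * β) • (C x - C y) := by module
    have h := hC x y
    rw [e]
    refine le_of_sq_le_sq ?_ (norm_nonneg _)
    rw [norm_sub_sq_real, real_inner_smul_right, norm_smul, Real.norm_eq_abs,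
      abs_of_pos (by linarith : 0 < 2 * β)]
    nlinarith
  have hs : 0 < 2 * β + γ := by linarith
  have hlip : LipschitzWith (Real.toNNReal (γ / (2 * β + γ)))
      (fun p : E => (2 * β + γ)⁻¹ • ((2 * β) • u + γ • (p - (2 * β) • C p))) := by
    refine LipschitzWith.of_dist_le_mul fun x y => ?_
    rw [dist_eq_norm, dist_eq_norm, Real.coe_toNNReal _ (by positivity)]
    have e : (2 * β + γ)⁻¹ • ((2 * β) • u + γ • (x - (2 * β) • C x))
        - (2 * β + γ)⁻¹ • ((2 * β) • u + γ • (y - (2 * β) • C y))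
        = (γ / (2 * β + γ)) • ((x - (2 * β) • C x) - (y - (2 * β) • C y)) := by
      match_scalars <;> field_simp; ring
    rw [e, norm_smul, Real.norm_eq_abs, abs_of_pos (by positivity)]
    exact mul_le_mul_of_nonneg_left (hN x y) (by positivity)
  have hcontr : ContractingWith (Real.toNNReal (γ / (2 * β + γ)))
      (fun p : E => (2 * β + γ)⁻¹ • ((2 * β) • u + γ • (p - (2 * β) • C p))) := by
    refine ⟨?_, hlip⟩
    rw [Real.toNNReal_lt_one, div_lt_one hs]
    linarith
  refine ⟨hcontr.fixedPoint, ?_⟩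
  have hfix := hcontr.fixedPoint_isFixedPt
  unfold Function.IsFixedPt at hfix
  set p := hcontr.fixedPoint
  rw [inv_smul_eq_iff₀ hs.ne'] at hfix
  have h2 : (2 * β) • (p + γ • C p) = (2 * β) • u := by
    have e : (2 * β) • (p + γ • C p) = (2 * β + γ) • p - γ • (p - (2 * β) • C p) := by module
    rw [e, ← hfix, add_sub_cancel_right]
  exact smul_right_injective E (by positivity : (2 * β) ≠ 0) h2

end Minty

/-! ### Weak limits tested against inner products. -/

section WeakLimits

variable {E : Type*} [NormedAddCommGroup E] [InnerProductSpace ℝ E]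

/-- Weak convergence along a filter, tested against inner products. -/
def WeakLim {ι : Type*} (l : Filter ι) (z : ι → E) (a : E) : Prop :=
  ∀ v, Tendsto (fun n => inner ℝ (z n) v) l (𝓝 (inner ℝ a v))

theorem WeakLim.sub_tendsto {ι : Type*} {l : Filter ι} {z u : ι → E} {a b : E}
    (hz : WeakLim l z a) (hu : Tendsto u l (𝓝 b)) :
    WeakLim l (fun n => z n - u n) (a - b) := fun v => by
  simpa only [inner_sub_left] using (hz v).sub (hu.inner tendsto_const_nhds)

theorem WeakLim.inner_tendsto {ι : Type*} {l : Filter ι} {z u : ι → E} {a b : E} {M : ℝ}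
    (hz : WeakLim l z a) (hM : ∀ n, ‖z n‖ ≤ M) (hu : Tendsto u l (𝓝 b)) :
    Tendsto (fun n => inner ℝ (z n) (u n)) l (𝓝 (inner ℝ a b)) := by
  have h0 : Tendsto (fun n => inner ℝ (z n) (u n - b)) l (𝓝 0) := by
    have h1 : Tendsto (fun n => M * ‖u n - b‖) l (𝓝 0) := by
      simpa using (tendsto_iff_norm_sub_tendsto_zero.1 hu).const_mul M
    exact squeeze_zero_norm (fun n => (norm_inner_le_norm _ _).trans
      (mul_le_mul_of_nonneg_right (hM n) (norm_nonneg _))) h1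
  have := (hz b).add h0
  rw [add_zero] at this
  refine this.congr fun n => ?_
  rw [← inner_add_right, add_sub_cancel]

theorem WeakLim.convergesWeakly [CompleteSpace E] {z : ℕ → E} {a : E}
    (h : WeakLim atTop z a) : ConvergesWeakly z a := by
  refine (WeakBilin.tendsto_iff_forall_eval_tendsto _
    (fun _ _ hxy => (SeparatingDual.eq_iff_forall_dual_eq (R := ℝ)).2 fun f => LinearMap.congr_fun hxy f)).2
      fun f => ?_
  have e : ∀ x : E, inner ℝ x ((InnerProductSpace.toDual ℝ E).symm f) = f x := fun x => by
    rw [real_inner_comm, InnerProductSpace.toDual_symm_apply]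
  have := h ((InnerProductSpace.toDual ℝ E).symm f)
  simp only [e] at this
  exact this

end WeakLimits

/-! ### Perturbed recursive inequalities for real sequences. -/

section RealSequences

/-- Discrete Grönwall: 1 + d is multiplied at each step by at most 1 + Pω n ≤ exp(Pω n), and ω is
summable. -/
theorem exists_bound_of_le_add_mul {d ω : ℕ → ℝ} {P : ℝ} (hP : 0 ≤ P) (hd : ∀ n, 0 ≤ d n)
    (hω : ∀ n, 0 ≤ ω n) (hs : Summable ω)
    (h : ∀ n, d (n + 1) ≤ d n + ω n * (P * (1 + d n))) : ∃ M, ∀ n, d n ≤ M := by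
  have key : ∀ n, 1 + d n ≤ Real.exp (P * ∑ k ∈ Finset.range n, ω k) * (1 + d 0) := by
    intro n
    induction n with
    | zero => simp
    | succ n ih =>
      have h1 : 1 + d (n + 1) ≤ (P * ω n + 1) * (1 + d n) := by linarith [h n]
      have h2 := Real.add_one_le_exp (P * ω n)
      rw [Finset.sum_range_succ, mul_add P, add_comm (P * _), Real.exp_add, mul_assoc]
      exact h1.trans (mul_le_mul h2 ih (by linarith [hd n]) (Real.exp_pos _).le)
  refine ⟨Real.exp (P * ∑' k, ω k) * (1 + d 0), fun n => ?_⟩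
  have h3 : Real.exp (P * ∑ k ∈ Finset.range n, ω k) ≤ Real.exp (P * ∑' k, ω k) :=
    Real.exp_le_exp.2 (mul_le_mul_of_nonneg_left (hs.sum_le_tsum _ fun k _ => hω k) hP)
  have h4 := mul_le_mul_of_nonneg_right h3 (by linarith [hd 0] : 0 ≤ 1 + d 0)
  linarith [key n]

/-- Subtracting the partial sums of ε leaves a nonincreasing sequence that is bounded below. -/
theorem exists_tendsto_of_le_add_summable {d ε : ℕ → ℝ} (hd : ∀ n, 0 ≤ d n)
    (hε : ∀ n, 0 ≤ ε n) (hs : Summable ε) (h : ∀ n, d (n + 1) ≤ d n + ε n) :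
    ∃ l, Tendsto d atTop (𝓝 l) := by
  have hanti : Antitone fun n => d n - ∑ k ∈ Finset.range n, ε k :=
    antitone_nat_of_succ_le fun n => by
      rw [Finset.sum_range_succ]; linarith [h n]
  have hbdd : BddBelow (Set.range fun n => d n - ∑ k ∈ Finset.range n, ε k) := by
    refine ⟨-∑' k, ε k, ?_⟩
    rintro _ ⟨n, rfl⟩
    have := hs.sum_le_tsum (Finset.range n) fun k _ => hε k
    simp only
    linarith [hd n]
  refine ⟨_, ((tendsto_atTop_ciInf hanti hbdd).add hs.hasSum.tendsto_sum_nat).congr fun n => ?_⟩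
  ring

theorem exists_geometric_bound {d : ℕ → ℝ} {θ η P : ℝ} (hd : ∀ n, 0 ≤ d n) (hθ0 : 0 ≤ θ)
    (hθ : θ < 1) (hη0 : 0 ≤ η) (hη : η < 1) (hP : 0 ≤ P)
    (h : ∀ n, d (n + 1) ≤ θ * d n + P * η ^ n) :
    ∃ M q : ℝ, 0 < q ∧ q < 1 ∧ ∀ n, d n ≤ M * q ^ n := by
  -- A ratio strictly above both θ and η avoids the resonant case θ = η. The constant M = d 0 + P/(q
  -- - θ) satisfies P ≤ (q - θ)M, which closes the induction.
  obtain ⟨q, hq, hq1⟩ := exists_between (max_lt hθ hη)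
  have hθq : θ < q := (le_max_left _ _).trans_lt hq
  have hηq : η < q := (le_max_right _ _).trans_lt hq
  have hq0 : 0 < q := hθ0.trans_lt hθq
  have hM0 : 0 ≤ P / (q - θ) := div_nonneg hP (by linarith)
  have hPM : P ≤ (q - θ) * (d 0 + P / (q - θ)) := by
    rw [mul_add, mul_div_cancel₀ _ (by linarith : q - θ ≠ 0)]
    nlinarith [hd 0]
  refine ⟨d 0 + P / (q - θ), q, hq0, hq1, fun n => ?_⟩
  induction n with
  | zero => simpa using hM0
  | succ n ih =>
    have h1 : η ^ n ≤ q ^ n := pow_le_pow_left₀ hη0 hηq.le n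
    have h2 : P * η ^ n ≤ (q - θ) * (d 0 + P / (q - θ)) * q ^ n :=
      mul_le_mul hPM h1 (pow_nonneg hη0 n) (hP.trans hPM)
    have h3 := mul_le_mul_of_nonneg_left ih hθ0
    calc d (n + 1) ≤ θ * ((d 0 + P / (q - θ)) * q ^ n)
          + (q - θ) * (d 0 + P / (q - θ)) * q ^ n := by linarith [h n]
      _ = (d 0 + P / (q - θ)) * q ^ (n + 1) := by ring

end RealSequences

/-! ### The exact step: Fejér inequality, contraction, perturbation, weak closedness. -/

section Step

variable {H : Type*} [NormedAddCommGroup H] [InnerProductSpace ℝ H]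

/-- The intermediate point of a forward-Douglas–Rachford-forward step. -/
def stepMid (JA JC T : H → H) (γ : ℝ) (z : H) : H :=
  JA ((2 : ℝ) • JC z - z - γ • T (JC z))

/-- A forward-Douglas–Rachford-forward step. -/
def step (JA JC T : H → H) (γ : ℝ) (z : H) : H :=
  (stepMid JA JC T γ z - γ • T (stepMid JA JC T γ z)) + z - (JC z - γ • T (JC z))

/-- Standing assumptions on the exact iteration for `0 ∈ A x + C x + T x`. -/
structure StepSetting (A : H → Set H) (C T JA JC : H → H) (ρ r β κ γ : ℝ) : Prop where
  β_pos : 0 < β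
  γ_pos : 0 < γ
  κ_nonneg : 0 ≤ κ
  r_nonneg : 0 ≤ r
  gap_pos : 0 < 1 - κ ^ 2 * γ ^ 2 * (1 + γ / (2 * β))
  ρ_lt : 0 < 1 + ρ * γ
  A_mono : IsRhoMonotone ρ A
  C_coco : IsCocoercive β C
  T_lip : IsLipschitzian κ T
  AT_mono : IsRhoMonotone r (addSingle A T)
  JA_spec : ∀ u, ∃ a ∈ A (JA u), JA u + γ • a = u
  JC_spec : ∀ u, JC u + γ • C (JC u) = u

namespace StepSetting

variable {A : H → Set H} {C T JA JC : H → H} {ρ r β κ γ : ℝ}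

theorem mul_lt_one (S : StepSetting A C T JA JC ρ r β κ γ) : γ * κ < 1 := by
  have h1 := S.gap_pos
  have h2 : 0 ≤ γ / (2 * β) := div_nonneg S.γ_pos.le (by linarith [S.β_pos])
  have h3 : (γ * κ) ^ 2 < 1 := by nlinarith [sq_nonneg (γ * κ)]
  nlinarith [mul_nonneg S.γ_pos.le S.κ_nonneg]

theorem JC_norm_sub_le (S : StepSetting A C T JA JC ρ r β κ γ) (u v : H) :
    ‖JC u - JC v‖ ≤ ‖u - v‖ := by
  have h := (S.C_coco.isRhoMonotone_single S.β_pos.le).norm_sub_le_of_add_smul S.γ_pos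
    (p := JC u) (q := JC v) rfl rfl
  rw [S.JC_spec, S.JC_spec] at h
  linarith

theorem JC_eq (S : StepSetting A C T JA JC ρ r β κ γ) {x u : H} (h : x + γ • C x = u) :
    JC u = x := by
  have h1 := (S.C_coco.isRhoMonotone_single S.β_pos.le).norm_sub_le_of_add_smul S.γ_pos
    (p := JC u) (q := x) rfl rfl
  rw [S.JC_spec, h, sub_self, norm_zero] at h1
  exact sub_eq_zero.1 (norm_le_zero_iff.1 (by linarith))

theorem JA_norm_sub_le (S : StepSetting A C T JA JC ρ r β κ γ) (u v : H) :
    ‖JA u - JA v‖ ≤ (1 + ρ * γ)⁻¹ * ‖u - v‖ := by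
  obtain ⟨a, ha, hau⟩ := S.JA_spec u
  obtain ⟨b, hb, hbv⟩ := S.JA_spec v
  have h := S.A_mono.norm_sub_le_of_add_smul S.γ_pos ha hb
  rw [hau, hbv] at h
  rw [inv_mul_eq_div, le_div_iff₀ S.ρ_lt]
  linarith

theorem JA_eq (S : StepSetting A C T JA JC ρ r β κ γ) {x a u : H} (ha : a ∈ A x)
    (h : x + γ • a = u) : JA u = x := by
  obtain ⟨b, hb, hbu⟩ := S.JA_spec u
  have h1 := S.A_mono.norm_sub_le_of_add_smul S.γ_pos hb ha
  rw [hbu, h, sub_self, norm_zero] at h1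
  have := S.ρ_lt
  exact sub_eq_zero.1 (norm_le_zero_iff.1 (by nlinarith [norm_nonneg (JA u - x)]))

/-- Substituting z = x + γCx turns the reflection 2x - z into the forward step x - γCx. -/
theorem stepMid_spec (S : StepSetting A C T JA JC ρ r β κ γ) (z : H) :
    ∃ a ∈ A (stepMid JA JC T γ z), stepMid JA JC T γ z + γ • a
      = JC z - γ • C (JC z) - γ • T (JC z) := by
  obtain ⟨a, ha, h⟩ := S.JA_spec ((2 : ℝ) • JC z - z - γ • T (JC z))
  refine ⟨a, ha, ?_⟩
  have h2 := S.JC_spec z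
  calc _ = (2 : ℝ) • JC z - z - γ • T (JC z) := h
    _ = (2 : ℝ) • JC z - (JC z + γ • C (JC z)) - γ • T (JC z) := by rw [h2]
    _ = _ := by module

/-- The Fejér-type inequality of the exact step. -/
theorem norm_step_sub_sq_le (S : StepSetting A C T JA JC ρ r β κ γ) (z zb : H)
    (hzb : -(C (JC zb) + T (JC zb)) ∈ A (JC zb)) :
    ‖step JA JC T γ z - zb‖ ^ 2 ≤ ‖z - zb‖ ^ 2
      - (1 - κ ^ 2 * γ ^ 2 * (1 + γ / (2 * β))) * ‖JC z - stepMid JA JC T γ z‖ ^ 2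
      - 2 * γ * r * ‖stepMid JA JC T γ z - JC zb‖ ^ 2
      - 2 * γ * β * ‖(C (JC z) - C (JC zb))
        + (γ / (2 * β)) • (T (stepMid JA JC T γ z) - T (JC z))‖ ^ 2 := by
  have hγ := S.γ_pos
  have hβ := S.β_pos
  obtain ⟨a, ha, hay⟩ := S.stepMid_spec z
  have hstep : step JA JC T γ z
      = stepMid JA JC T γ z - γ • T (stepMid JA JC T γ z) + z - (JC z - γ • T (JC z)) := rfl
  have hz := S.JC_spec z
  have hzb' := S.JC_spec zb
  rw [hstep]
  clear hstep
  generalize stepMid JA JC T γ z = y at *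
  generalize JC z = x at *
  generalize JC zb = xb at *
  subst hz hzb'
  have hmono := S.AT_mono y xb (a + T y) ⟨a, ha, rfl⟩ (-(C xb + T xb) + T xb) ⟨_, hzb, rfl⟩
  have hcoco := S.C_coco x xb
  have hlip := S.T_lip y x
  have hd : γ • ((a + T y) - (-(C xb + T xb) + T xb))
      = (x - y) + γ • (T y - T x) - γ • (C x - C xb) := by
    have : γ • a = x - γ • C x - γ • T x - y := by rw [← hay]; abel
    calc γ • ((a + T y) - (-(C xb + T xb) + T xb)) = γ • a + γ • T y + γ • C xb := by module
      _ = _ := by rw [this]; module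
  have hmono' : γ * (r * ‖y - xb‖ ^ 2)
      ≤ inner ℝ (y - xb) ((x - y) + γ • (T y - T x) - γ • (C x - C xb)) := by
    rw [← hd, real_inner_smul_right]
    exact mul_le_mul_of_nonneg_left hmono hγ.le
  have e1 : x - xb = (x - y) + (y - xb) := by abel
  have e2 : y - γ • T y + (x + γ • C x) - (x - γ • T x) - (xb + γ • C xb)
      = (y - xb) + γ • (C x - C xb) - γ • (T y - T x) := by module
  have e3 : x + γ • C x - (xb + γ • C xb) = (x - y) + (y - xb) + γ • (C x - C xb) := by module
  rw [e1] at hcoco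
  rw [norm_sub_rev y x] at hlip
  rw [e2, e3]
  generalize x - y = p at *
  generalize y - xb = d at *
  generalize C x - C xb = e at *
  generalize T y - T x = t at *
  have ht : ‖t‖ ^ 2 ≤ κ ^ 2 * ‖p‖ ^ 2 := by
    rw [← mul_pow]
    exact pow_le_pow_left₀ (norm_nonneg _) hlip 2
  have hγβ : 0 ≤ γ / (2 * β) := by positivity
  have ht' := mul_le_mul_of_nonneg_left ht
    (by positivity : 0 ≤ γ ^ 2 * (1 + γ / (2 * β)))
  have hc' := mul_le_mul_of_nonneg_left hcoco hγ.le
  -- Completing the square in e absorbs the cross term ⟪e, t⟫ at the cost of γ²(γ/(2β))‖t‖². This is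
  -- the origin of the factor 1 + γ/(2β) in the step size condition.
  have hs : 2 * γ * β * ‖e + (γ / (2 * β)) • t‖ ^ 2 = 2 * γ * β * ‖e‖ ^ 2
      + 2 * γ ^ 2 * inner ℝ e t + γ ^ 2 * (γ / (2 * β)) * ‖t‖ ^ 2 := by
    rw [norm_add_sq_real, real_inner_smul_right, norm_smul, mul_pow, Real.norm_eq_abs, sq_abs]
    field_simp
  rw [hs]
  simp only [norm_add_sq_real, norm_sub_sq_real, inner_add_left, inner_add_right,
    inner_sub_right, real_inner_smul_right, real_inner_smul_left, norm_smul, mul_pow,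
    Real.norm_eq_abs, sq_abs] at *
  rw [real_inner_comm p d] at *
  linarith

theorem norm_step_sub_le (S : StepSetting A C T JA JC ρ r β κ γ) (z zb : H)
    (hzb : -(C (JC zb) + T (JC zb)) ∈ A (JC zb)) :
    ‖step JA JC T γ z - zb‖ ≤ ‖z - zb‖ := by
  have h := S.norm_step_sub_sq_le z zb hzb
  have h1 := mul_nonneg S.gap_pos.le (sq_nonneg ‖JC z - stepMid JA JC T γ z‖)
  have h2 := mul_nonneg (mul_nonneg (mul_nonneg zero_le_two S.γ_pos.le) S.r_nonneg)
    (sq_nonneg ‖stepMid JA JC T γ z - JC zb‖)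
  have h3 := mul_nonneg (mul_nonneg (mul_nonneg zero_le_two S.γ_pos.le) S.β_pos.le)
    (sq_nonneg ‖(C (JC z) - C (JC zb))
        + (γ / (2 * β)) • (T (stepMid JA JC T γ z) - T (JC z))‖)
  exact le_of_sq_le_sq (by linarith) (norm_nonneg _)

/-- With r > 0 the Fejér decrease dominates ‖x - y‖² + ‖y - x̄‖², hence ‖x - x̄‖², hence ‖z - zb‖²,
because Id + γC, which maps x back to z, is Lipschitzian. -/
theorem exists_contraction (S : StepSetting A C T JA JC ρ r β κ γ) (hr : 0 < r) :
    ∃ θ, 0 ≤ θ ∧ θ < 1 ∧ ∀ z zb, -(C (JC zb) + T (JC zb)) ∈ A (JC zb) →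
      ‖step JA JC T γ z - zb‖ ≤ θ * ‖z - zb‖ := by
  have hγ := S.γ_pos
  have hβ := S.β_pos
  set χ := 1 - κ ^ 2 * γ ^ 2 * (1 + γ / (2 * β)) with hχ
  have hχ0 : 0 < χ := S.gap_pos
  have hχ1 : χ ≤ 1 := by
    have : 0 ≤ κ ^ 2 * γ ^ 2 * (1 + γ / (2 * β)) := by positivity
    linarith
  set m := min χ (2 * γ * r) with hm
  have hm0 : 0 < m := lt_min hχ0 (by positivity)
  have hm1 : m ≤ χ := min_le_left _ _
  have hm2 : m ≤ 2 * γ * r := min_le_right _ _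
  -- A Lipschitz constant of Id + γC. The 2 in m/(2s²) comes from (a + b)² ≤ 2(a² + b²).
  set s := 1 + γ / β with hs
  have hs1 : 1 ≤ s := by
    have : 0 ≤ γ / β := by positivity
    linarith
  have hδ : m / (2 * s ^ 2) ≤ 1 := by
    rw [div_le_one (by positivity)]
    nlinarith
  have hδ0 : 0 < m / (2 * s ^ 2) := by positivity
  refine ⟨√(1 - m / (2 * s ^ 2)), Real.sqrt_nonneg _, ?_, fun z zb hzb => ?_⟩
  · rw [Real.sqrt_lt' one_pos]; linarith
  have h := S.norm_step_sub_sq_le z zb hzb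
  have h3 := mul_nonneg (mul_nonneg (mul_nonneg zero_le_two hγ.le) hβ.le)
    (sq_nonneg ‖(C (JC z) - C (JC zb))
        + (γ / (2 * β)) • (T (stepMid JA JC T γ z) - T (JC z))‖)
  have hX : ‖JC z - JC zb‖ ≤ ‖JC z - stepMid JA JC T γ z‖ + ‖stepMid JA JC T γ z - JC zb‖ :=
    norm_sub_le_norm_sub_add_norm_sub _ _ _
  have hZ : ‖z - zb‖ ≤ s * ‖JC z - JC zb‖ := by
    have e : z - zb = (JC z - JC zb) + γ • (C (JC z) - C (JC zb)) := by
      conv_lhs => rw [← S.JC_spec z, ← S.JC_spec zb]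
      module
    have h1 : ‖C (JC z) - C (JC zb)‖ ≤ ‖JC z - JC zb‖ / β := by
      rw [le_div_iff₀ hβ, mul_comm]
      exact S.C_coco.norm_sub_le _ _
    calc ‖z - zb‖ ≤ ‖JC z - JC zb‖ + ‖γ • (C (JC z) - C (JC zb))‖ := by
          rw [e]; exact norm_add_le _ _
      _ ≤ ‖JC z - JC zb‖ + γ * (‖JC z - JC zb‖ / β) := by
          rw [norm_smul, Real.norm_eq_abs, abs_of_pos hγ]
          gcongr
      _ = _ := by rw [hs]; ring
  rw [← Real.sqrt_sq (norm_nonneg (z - zb)), ← Real.sqrt_mul (by linarith)]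
  refine Real.le_sqrt_of_sq_le ?_
  have hD : ‖z - zb‖ ^ 2 ≤ 2 * s ^ 2 * (‖JC z - stepMid JA JC T γ z‖ ^ 2
      + ‖stepMid JA JC T γ z - JC zb‖ ^ 2) := by
    calc ‖z - zb‖ ^ 2 ≤ (s * (‖JC z - stepMid JA JC T γ z‖
          + ‖stepMid JA JC T γ z - JC zb‖)) ^ 2 := by
          gcongr
          exact hZ.trans (by gcongr)
      _ ≤ _ := by
          rw [mul_pow]
          nlinarith [mul_nonneg (sq_nonneg s) (sq_nonneg (‖JC z - stepMid JA JC T γ z‖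
            - ‖stepMid JA JC T γ z - JC zb‖))]
  have hD' : m / (2 * s ^ 2) * ‖z - zb‖ ^ 2 ≤ m * (‖JC z - stepMid JA JC T γ z‖ ^ 2
      + ‖stepMid JA JC T γ z - JC zb‖ ^ 2) := by
    calc _ ≤ m / (2 * s ^ 2) * (2 * s ^ 2 * (‖JC z - stepMid JA JC T γ z‖ ^ 2
      + ‖stepMid JA JC T γ z - JC zb‖ ^ 2)) := mul_le_mul_of_nonneg_left hD hδ0.le
      _ = _ := by field_simp
  have h4 := mul_le_mul_of_nonneg_right hm1 (sq_nonneg ‖JC z - stepMid JA JC T γ z‖)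
  have h5 := mul_le_mul_of_nonneg_right hm2 (sq_nonneg ‖stepMid JA JC T γ z - JC zb‖)
  linarith

/-- Perturbing `T` perturbs the step proportionally. -/
theorem exists_perturbation_bound (S : StepSetting A C T JA JC ρ r β κ γ) (zb : H)
    (hzb : -(C (JC zb) + T (JC zb)) ∈ A (JC zb)) (W c : ℝ) (hW : 0 ≤ W) (hc : 0 ≤ c) :
    ∃ P, 0 ≤ P ∧ ∀ (ε : ℝ) (T' : H → H), 0 ≤ ε → ε ≤ W →
      (∀ x, ‖T' x - T x‖ ≤ ε * (c * (1 + ‖x - JC zb‖))) → ∀ z,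
      ‖step JA JC T' γ z - step JA JC T γ z‖ ≤ ε * (P * (1 + ‖z - zb‖)) := by
  have hγ := S.γ_pos
  have hκ := S.κ_nonneg
  have hρ := S.ρ_lt
  set l := (1 + ρ * γ)⁻¹ with hl
  have hl0 : 0 ≤ l := (inv_pos.2 hρ).le
  -- Growth constant of the perturbed midpoint, as established in `h4`. The cap W on ε keeps it
  -- independent of ε.
  set Q := 1 + l * γ * W * c + l * (3 + γ * κ) with hQ
  refine ⟨l * γ * c + γ * (c * Q + κ * (l * γ * c)) + γ * c, by positivity, ?_⟩
  intro ε T' hε hεW hT' z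
  have hmidb : stepMid JA JC T γ zb = JC zb := by
    refine S.JA_eq hzb ?_
    have h := S.JC_spec zb
    calc JC zb + γ • -(C (JC zb) + T (JC zb))
        = (2 : ℝ) • JC zb - (JC zb + γ • C (JC zb)) - γ • T (JC zb) := by module
      _ = _ := by rw [h]
  set N := 1 + ‖z - zb‖ with hN
  have hN1 : 1 ≤ N := by linarith [norm_nonneg (z - zb)]
  have hx : ‖JC z - JC zb‖ ≤ ‖z - zb‖ := S.JC_norm_sub_le _ _
  have h1 : ‖T' (JC z) - T (JC z)‖ ≤ ε * (c * N) :=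
    (hT' _).trans (by gcongr; linarith)
  have h2 : ‖stepMid JA JC T' γ z - stepMid JA JC T γ z‖ ≤ l * (γ * (ε * (c * N))) := by
    refine (S.JA_norm_sub_le _ _).trans ?_
    have e : (2 : ℝ) • JC z - z - γ • T' (JC z) - ((2 : ℝ) • JC z - z - γ • T (JC z))
        = -(γ • (T' (JC z) - T (JC z))) := by module
    rw [e, norm_neg, norm_smul, Real.norm_eq_abs, abs_of_pos hγ]
    gcongr
  have h3 : ‖stepMid JA JC T γ z - JC zb‖ ≤ l * ((3 + γ * κ) * N) := by
    rw [← hmidb]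
    refine (S.JA_norm_sub_le _ _).trans ?_
    have e : (2 : ℝ) • JC z - z - γ • T (JC z) - ((2 : ℝ) • JC zb - zb - γ • T (JC zb))
        = (2 : ℝ) • (JC z - JC zb) - (z - zb) - γ • (T (JC z) - T (JC zb)) := by module
    rw [e]
    have i1 := norm_sub_le ((2 : ℝ) • (JC z - JC zb) - (z - zb)) (γ • (T (JC z) - T (JC zb)))
    have i2 := norm_sub_le ((2 : ℝ) • (JC z - JC zb)) (z - zb)
    rw [norm_smul, Real.norm_eq_abs, abs_of_pos hγ] at i1
    rw [norm_smul, Real.norm_eq_abs, abs_two] at i2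
    have i3 := mul_le_mul_of_nonneg_left
      ((S.T_lip (JC z) (JC zb)).trans (mul_le_mul_of_nonneg_left hx hκ)) hγ.le
    have i4 := mul_nonneg hγ.le hκ
    refine mul_le_mul_of_nonneg_left ?_ hl0
    rw [hN]
    linarith
  have h4 : 1 + ‖stepMid JA JC T' γ z - JC zb‖ ≤ Q * N := by
    have i1 := norm_sub_le_norm_sub_add_norm_sub (stepMid JA JC T' γ z)
      (stepMid JA JC T γ z) (JC zb)
    have i2 : l * (γ * (ε * (c * N))) ≤ l * (γ * (W * (c * N))) := by gcongr
    rw [hQ]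
    linarith
  have h5 : ‖T' (stepMid JA JC T' γ z) - T (stepMid JA JC T' γ z)‖ ≤ ε * (c * (Q * N)) :=
    (hT' _).trans (by gcongr)
  have h6 := (S.T_lip (stepMid JA JC T' γ z) (stepMid JA JC T γ z)).trans
    (mul_le_mul_of_nonneg_left h2 hκ)
  have e : step JA JC T' γ z - step JA JC T γ z
      = (stepMid JA JC T' γ z - stepMid JA JC T γ z)
        - γ • ((T' (stepMid JA JC T' γ z) - T (stepMid JA JC T' γ z))
          + (T (stepMid JA JC T' γ z) - T (stepMid JA JC T γ z)))
        + γ • (T' (JC z) - T (JC z)) := by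
    unfold step; module
  rw [e]
  refine (norm_add_le _ _).trans ?_
  refine (add_le_add_left (norm_sub_le _ _) _).trans ?_
  rw [norm_smul, norm_smul, Real.norm_eq_abs, abs_of_pos hγ]
  have i1 := mul_le_mul_of_nonneg_left ((norm_add_le _ _).trans (add_le_add h5 h6)) hγ.le
  have i2 := mul_le_mul_of_nonneg_left h1 hγ.le
  linarith

/-- Weak cluster points of an asymptotically regular sequence are fixed points. -/
theorem weakLim_spec (S : StepSetting A C T JA JC ρ r β κ γ) {ι : Type*} {l : Filter ι}
    [l.NeBot] {z : ι → H} {M : ℝ} (hM : ∀ n, ‖z n‖ ≤ M) {a b : H} (hz : WeakLim l z a)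
    (hxy : Tendsto (fun n => JC (z n) - stepMid JA JC T γ (z n)) l (𝓝 0))
    (hxyM : ∀ n, ‖JC (z n) - stepMid JA JC T γ (z n)‖ ≤ M)
    (hCx : Tendsto (fun n => C (JC (z n))) l (𝓝 b)) :
    stepMid JA JC T γ a = JC a ∧ C (JC a) = b ∧ -(C (JC a) + T (JC a)) ∈ A (JC a) := by
  have hγ := S.γ_pos
  have hβ := S.β_pos
  have hMx : ∀ n, ‖JC (z n)‖ ≤ M + ‖JC 0‖ := fun n => by
    have h1 := S.JC_norm_sub_le (z n) 0
    have h2 := norm_sub_norm_le (JC (z n)) (JC 0)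
    rw [sub_zero] at h1
    linarith [hM n]
  have hx : WeakLim l (fun n => JC (z n)) (a - γ • b) := by
    have := hz.sub_tendsto (hCx.const_smul γ)
    refine fun v => (this v).congr fun n => ?_
    beta_reduce
    rw [show z n - γ • C (JC (z n)) = JC (z n) from sub_eq_of_eq_add (S.JC_spec (z n)).symm]
  set x := a - γ • b with hxdef
  -- Pass to the limit in the cocoercivity inequality: the pairing of a weakly null sequence with a
  -- strongly convergent one tends to 0.
  have hCb : C x = b := by
    have h1 : Tendsto (fun n => inner ℝ (JC (z n) - x) (C (JC (z n)) - C x)) l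
        (𝓝 (inner ℝ (x - x) (b - C x))) :=
      (hx.sub_tendsto (tendsto_const_nhds (x := x))).inner_tendsto
        (M := M + ‖JC 0‖ + ‖x‖) (fun n => (norm_sub_le _ _).trans (by linarith [hMx n]))
        (hCx.sub_const _)
    have h2 : Tendsto (fun n => β * ‖C (JC (z n)) - C x‖ ^ 2) l (𝓝 (β * ‖b - C x‖ ^ 2)) :=
      ((hCx.sub_const _).norm.pow 2).const_mul β
    have h3 := le_of_tendsto_of_tendsto' h2 h1 fun n => S.C_coco _ _
    rw [sub_self, inner_zero_left] at h3
    have h4 : ‖b - C x‖ ^ 2 ≤ 0 := by nlinarith [sq_nonneg ‖b - C x‖]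
    have h5 : ‖b - C x‖ = 0 := by nlinarith [norm_nonneg (b - C x), sq_nonneg ‖b - C x‖]
    exact (sub_eq_zero.1 (norm_eq_zero.1 h5)).symm
  have hJCa : JC a = x := S.JC_eq (by rw [hCb, hxdef, sub_add_cancel])
  -- Instead of closedness of a sum of graphs, compare with the midpoint y of the step at a.
  -- Monotonicity of A + T between the n-th midpoint and y gives, in the limit, ‖x - y‖² ≤ γ⟪x - y,
  -- Tx - Ty⟫, so y = x because γκ < 1.
  obtain ⟨v, hv, hyv⟩ := S.stepMid_spec a
  rw [hJCa] at hyv ⊢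
  set y := stepMid JA JC T γ a with hy
  have hTlim : Tendsto (fun n => T (stepMid JA JC T γ (z n)) - T (JC (z n))) l (𝓝 0) := by
    refine squeeze_zero_norm (fun n => S.T_lip _ _) ?_
    simp only [norm_sub_rev (stepMid JA JC T γ _)]
    simpa using hxy.norm.const_mul κ
  have hmid : WeakLim l (fun n => stepMid JA JC T γ (z n) - y) (x - y) := by
    have := (hx.sub_tendsto hxy).sub_tendsto (tendsto_const_nhds (x := y))
    simpa using this
  have hineq : ∀ n, 0 ≤ inner ℝ (stepMid JA JC T γ (z n) - y)
      ((JC (z n) - stepMid JA JC T γ (z n))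
        + γ • (T (stepMid JA JC T γ (z n)) - T (JC (z n))) - γ • C (JC (z n))
        - γ • (v + T y)) := fun n => by
    obtain ⟨w, hw, hyw⟩ := S.stepMid_spec (z n)
    have h1 := S.AT_mono _ _ (w + T (stepMid JA JC T γ (z n))) ⟨w, hw, rfl⟩ (v + T y)
      ⟨v, hv, rfl⟩
    have h2 : γ • w = JC (z n) - γ • C (JC (z n)) - γ • T (JC (z n))
        - stepMid JA JC T γ (z n) := by rw [← hyw]; abel
    have e : (JC (z n) - stepMid JA JC T γ (z n))
        + γ • (T (stepMid JA JC T γ (z n)) - T (JC (z n))) - γ • C (JC (z n))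
        - γ • (v + T y) = γ • ((w + T (stepMid JA JC T γ (z n))) - (v + T y)) := by
      calc _ = (JC (z n) - γ • C (JC (z n)) - γ • T (JC (z n)) - stepMid JA JC T γ (z n))
          + γ • T (stepMid JA JC T γ (z n)) - γ • (v + T y) := by module
        _ = _ := by rw [← h2]; module
    rw [e, real_inner_smul_right]
    exact mul_nonneg hγ.le ((mul_nonneg S.r_nonneg (sq_nonneg _)).trans h1)
  have hlim := hmid.inner_tendsto (M := M + (M + ‖JC 0‖) + ‖y‖) (fun n => by
      have e : stepMid JA JC T γ (z n) - y
          = JC (z n) - (JC (z n) - stepMid JA JC T γ (z n)) - y := by abel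
      rw [e]
      have i1 := norm_sub_le (JC (z n) - (JC (z n) - stepMid JA JC T γ (z n))) y
      have i2 := norm_sub_le (JC (z n)) (JC (z n) - stepMid JA JC T γ (z n))
      linarith [hMx n, hxyM n])
    (((hxy.add (hTlim.const_smul γ)).sub (hCx.const_smul γ)).sub_const (γ • (v + T y)))
  have h0 := ge_of_tendsto' hlim hineq
  have e : (0 : H) + γ • (0 : H) - γ • b - γ • (v + T y)
      = γ • (T x - T y) - (x - y) := by
    have h2 : γ • v = x - γ • b - γ • T x - y := by rw [← hCb, ← hyv]; abel
    calc _ = - γ • b - γ • v - γ • T y := by module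
      _ = _ := by rw [h2]; module
  rw [e, inner_sub_right, real_inner_smul_right, real_inner_self_eq_norm_sq] at h0
  have h1 := (real_inner_le_norm (x - y) (T x - T y)).trans
    (mul_le_mul_of_nonneg_left (S.T_lip x y) (norm_nonneg _))
  have h2 := S.mul_lt_one
  have h3 : ‖x - y‖ ^ 2 ≤ 0 := by
    have := mul_le_mul_of_nonneg_left h1 hγ.le
    by_contra! hcon
    nlinarith
  have h4 : ‖x - y‖ = 0 := by nlinarith [norm_nonneg (x - y), sq_nonneg ‖x - y‖]
  have hxy' : x = y := sub_eq_zero.1 (norm_eq_zero.1 h4)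
  refine ⟨hxy'.symm, hCb, ?_⟩
  have h5 : γ • v = γ • (-(C x + T x)) := by
    have : γ • v = x - γ • C x - γ • T x - y := by rw [← hyv]; abel
    rw [this, ← hxy']; module
  rw [← smul_right_injective H hγ.ne' h5, hxy']
  exact hv

end StepSetting

end Step

/-! ### Convergence of the perturbed iteration. -/

section Convergence

variable {H : Type*} [NormedAddCommGroup H] [InnerProductSpace ℝ H]

theorem tendsto_zero_of_mul_norm_sq_le {E : Type*} [NormedAddCommGroup E] {u : ℕ → E} {g : ℕ → ℝ} {c : ℝ} (hc : 0 < c)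
    (h : ∀ n, c * ‖u n‖ ^ 2 ≤ g n) (hg : Tendsto g atTop (𝓝 0)) : Tendsto u atTop (𝓝 0) := by
  have h1 : Tendsto (fun n => √(g n / c)) atTop (𝓝 0) := by
    simpa using (hg.div_const c).sqrt
  refine squeeze_zero_norm (fun n => Real.le_sqrt_of_sq_le ?_) h1
  rw [le_div_iff₀ hc, mul_comm]
  exact h n

namespace StepSetting

variable {A : H → Set H} {C T JA JC : H → H} {ρ r β κ γ : ℝ}

/-- The error is first bounded relative to 1 + ‖z n - zb‖. Grönwall bounds this factor, and the
errors become summable uniformly. -/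
theorem exists_step_error_bound (S : StepSetting A C T JA JC ρ r β κ γ) {T' : ℕ → H → H}
    {ω : ℕ → ℝ} {z : ℕ → H} (hω : ∀ n, 0 ≤ ω n) (hs : Summable ω)
    (hT' : ∀ xb, ∃ c, 0 ≤ c ∧ ∀ n x, ‖T' n x - T x‖ ≤ ω n * (c * (1 + ‖x - xb‖)))
    (hz : ∀ n, z (n + 1) = step JA JC (T' n) γ (z n)) {zb : H}
    (hzb : -(C (JC zb) + T (JC zb)) ∈ A (JC zb)) :
    ∃ Q, 0 ≤ Q ∧ ∀ n, ‖z (n + 1) - step JA JC T γ (z n)‖ ≤ ω n * Q := by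
  obtain ⟨c, hc, hcT⟩ := hT' (JC zb)
  obtain ⟨P, hP, hPT⟩ := S.exists_perturbation_bound zb hzb (∑' n, ω n) c (tsum_nonneg hω) hc
  have herr : ∀ n, ‖z (n + 1) - step JA JC T γ (z n)‖ ≤ ω n * (P * (1 + ‖z n - zb‖)) :=
    fun n => by
      rw [hz n]
      exact hPT (ω n) (T' n) (hω n) (hs.le_tsum n fun k _ => hω k) (hcT n) (z n)
  obtain ⟨M, hM⟩ := exists_bound_of_le_add_mul hP (d := fun n => ‖z n - zb‖)
    (fun n => norm_nonneg _) hω hs (fun n => by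
      have h1 := norm_sub_le_norm_sub_add_norm_sub (z (n + 1)) (step JA JC T γ (z n)) zb
      have h2 := S.norm_step_sub_le (z n) zb hzb
      linarith [herr n])
  have hM0 : 0 ≤ M := (norm_nonneg _).trans (hM 0)
  refine ⟨P * (1 + M), by positivity, fun n => (herr n).trans ?_⟩
  exact mul_le_mul_of_nonneg_left (mul_le_mul_of_nonneg_left (by linarith [hM n]) hP) (hω n)

theorem asymptotic_regularity (S : StepSetting A C T JA JC ρ r β κ γ) {T' : ℕ → H → H}
    {ω : ℕ → ℝ} {z : ℕ → H} (hω : ∀ n, 0 ≤ ω n) (hs : Summable ω)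
    (hT' : ∀ xb, ∃ c, 0 ≤ c ∧ ∀ n x, ‖T' n x - T x‖ ≤ ω n * (c * (1 + ‖x - xb‖)))
    (hz : ∀ n, z (n + 1) = step JA JC (T' n) γ (z n)) {zb : H}
    (hzb : -(C (JC zb) + T (JC zb)) ∈ A (JC zb)) :
    (∃ l, Tendsto (fun n => ‖z n - zb‖) atTop (𝓝 l)) ∧
      Tendsto (fun n => JC (z n) - stepMid JA JC T γ (z n)) atTop (𝓝 0) ∧
      Tendsto (fun n => C (JC (z n))) atTop (𝓝 (C (JC zb))) := by
  have hγ := S.γ_pos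
  have hβ := S.β_pos
  obtain ⟨Q, hQ, herr⟩ := S.exists_step_error_bound hω hs hT' hz hzb
  have hstep : ∀ n, ‖step JA JC T γ (z n) - zb‖ ≤ ‖z n - zb‖ :=
    fun n => S.norm_step_sub_le (z n) zb hzb
  have hsucc : ∀ n, ‖z (n + 1) - zb‖ ≤ ‖step JA JC T γ (z n) - zb‖ + ω n * Q := fun n => by
    have h1 := norm_sub_le_norm_sub_add_norm_sub (z (n + 1)) (step JA JC T γ (z n)) zb
    linarith [herr n]
  have hεs : Summable fun n => ω n * Q := hs.mul_right Q
  obtain ⟨l, hl⟩ := exists_tendsto_of_le_add_summable (d := fun n => ‖z n - zb‖)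
    (fun n => norm_nonneg _) (fun n => mul_nonneg (hω n) hQ) hεs
    (fun n => (hsucc n).trans (by linarith [hstep n]))
  -- Squeezed between ‖z (n + 1) - zb‖ - ω n * Q and ‖z n - zb‖, so the Fejér decrease tends to 0.
  have he : Tendsto (fun n => ‖step JA JC T γ (z n) - zb‖) atTop (𝓝 l) := by
    have h1 := (hl.comp (tendsto_add_atTop_nat 1)).sub hεs.tendsto_atTop_zero
    rw [sub_zero] at h1
    refine tendsto_of_tendsto_of_tendsto_of_le_of_le h1 hl (fun n => ?_) hstep
    have := hsucc n
    simp only [Function.comp]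
    linarith
  have hgap : Tendsto (fun n => ‖z n - zb‖ ^ 2 - ‖step JA JC T γ (z n) - zb‖ ^ 2) atTop
      (𝓝 0) := by
    simpa using (hl.pow 2).sub (he.pow 2)
  have hfe := fun n => S.norm_step_sub_sq_le (z n) zb hzb
  have n1 := fun n => mul_nonneg S.gap_pos.le
    (sq_nonneg ‖JC (z n) - stepMid JA JC T γ (z n)‖)
  have n2 := fun n => mul_nonneg (mul_nonneg (mul_nonneg zero_le_two hγ.le) S.r_nonneg)
    (sq_nonneg ‖stepMid JA JC T γ (z n) - JC zb‖)
  have n3 := fun n => mul_nonneg (mul_nonneg (mul_nonneg zero_le_two hγ.le) hβ.le)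
    (sq_nonneg ‖(C (JC (z n)) - C (JC zb))
        + (γ / (2 * β)) • (T (stepMid JA JC T γ (z n)) - T (JC (z n)))‖)
  have hp : Tendsto (fun n => JC (z n) - stepMid JA JC T γ (z n)) atTop (𝓝 0) :=
    tendsto_zero_of_mul_norm_sq_le S.gap_pos
      (fun n => by linarith [hfe n, n2 n, n3 n]) hgap
  have hq : Tendsto (fun n => (C (JC (z n)) - C (JC zb))
      + (γ / (2 * β)) • (T (stepMid JA JC T γ (z n)) - T (JC (z n)))) atTop (𝓝 0) :=
    tendsto_zero_of_mul_norm_sq_le (mul_pos (mul_pos two_pos hγ) hβ)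
      (fun n => by linarith [hfe n, n1 n, n2 n]) hgap
  have hT : Tendsto (fun n => T (stepMid JA JC T γ (z n)) - T (JC (z n))) atTop (𝓝 0) := by
    refine squeeze_zero_norm (fun n => S.T_lip _ _) ?_
    simp only [norm_sub_rev (stepMid JA JC T γ _)]
    simpa using hp.norm.const_mul κ
  refine ⟨⟨l, hl⟩, hp, ?_⟩
  have := (hq.sub (hT.const_smul (γ / (2 * β)))).add_const (C (JC zb))
  simpa using this

/-- Opial's argument over ultrafilters. The distances to two weak cluster points a, a' both
converge, so ⟪z n, a - a'⟫ converges along the whole sequence, which forces a = a'. The resolvents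
follow since J_{γC} z = z - γ C J_{γC} z and the last term converges strongly. -/
theorem exists_weakLim [CompleteSpace H] (S : StepSetting A C T JA JC ρ r β κ γ)
    {T' : ℕ → H → H} {ω : ℕ → ℝ} {z : ℕ → H} (hω : ∀ n, 0 ≤ ω n) (hs : Summable ω)
    (hT' : ∀ xb, ∃ c, 0 ≤ c ∧ ∀ n x, ‖T' n x - T x‖ ≤ ω n * (c * (1 + ‖x - xb‖)))
    (hz : ∀ n, z (n + 1) = step JA JC (T' n) γ (z n)) {zb : H}
    (hzb : -(C (JC zb) + T (JC zb)) ∈ A (JC zb)) :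
    ∃ a, stepMid JA JC T γ a = JC a ∧ -(C (JC a) + T (JC a)) ∈ A (JC a) ∧
      WeakLim atTop z a ∧ WeakLim atTop (fun n => JC (z n)) (JC a) := by
  obtain ⟨⟨l, hl⟩, hp, hC⟩ := S.asymptotic_regularity hω hs hT' hz hzb
  obtain ⟨M₁, hM₁⟩ := hl.bddAbove_range
  obtain ⟨M₂, hM₂⟩ := hp.norm.bddAbove_range
  have hzM : ∀ n, ‖z n‖ ≤ max (M₁ + ‖zb‖) M₂ := fun n => by
    have h1 : ‖z n - zb‖ ≤ M₁ := hM₁ ⟨n, rfl⟩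
    have h2 := norm_sub_norm_le (z n) zb
    exact le_max_of_le_left (by linarith)
  have hpM : ∀ n, ‖JC (z n) - stepMid JA JC T γ (z n)‖ ≤ max (M₁ + ‖zb‖) M₂ :=
    fun n => le_max_of_le_right (hM₂ ⟨n, rfl⟩)
  have hU : ∀ U : Ultrafilter ℕ, (U : Filter ℕ) ≤ atTop → ∃ a, WeakLim (U : Filter ℕ) z a ∧
      stepMid JA JC T γ a = JC a ∧ C (JC a) = C (JC zb) ∧
      -(C (JC a) + T (JC a)) ∈ A (JC a) := fun U hU => by
    obtain ⟨a, ha⟩ := exists_weak_limit U z _ (Eventually.of_forall hzM)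
    exact ⟨a, ha, S.weakLim_spec hzM ha (hp.mono_left hU) hpM (hC.mono_left hU)⟩
  obtain ⟨a, ha, hmid, hCa, hsol⟩ := hU (Ultrafilter.of atTop) (Ultrafilter.of_le _)
  have hlim : WeakLim atTop z a := fun v => by
    rw [tendsto_iff_ultrafilter]
    intro U hUle
    obtain ⟨a', ha', -, -, hsol'⟩ := hU U hUle
    obtain ⟨⟨m, hm⟩, -⟩ := S.asymptotic_regularity hω hs hT' hz hsol
    obtain ⟨⟨m', hm'⟩, -⟩ := S.asymptotic_regularity hω hs hT' hz hsol'
    have hconv : Tendsto (fun n => inner ℝ (z n) (a - a')) atTop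
        (𝓝 ((m' ^ 2 - m ^ 2 + ‖a‖ ^ 2 - ‖a'‖ ^ 2) / 2)) := by
      refine (((((hm'.pow 2).sub (hm.pow 2)).add_const (‖a‖ ^ 2)).sub_const
        (‖a'‖ ^ 2)).div_const 2).congr fun n => ?_
      rw [norm_sub_sq_real, norm_sub_sq_real, inner_sub_right]
      ring
    have h1 := tendsto_nhds_unique (ha (a - a')) (hconv.mono_left (Ultrafilter.of_le _))
    have h2 := tendsto_nhds_unique (ha' (a - a')) (hconv.mono_left hUle)
    have h3 : inner ℝ (a - a') (a - a') = (0 : ℝ) := by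
      rw [inner_sub_left, h1, h2, sub_self]
    have h4 : a = a' := sub_eq_zero.1 (inner_self_eq_zero.1 h3)
    rw [h4]
    exact ha' v
  refine ⟨a, hmid, hsol, hlim, ?_⟩
  have h1 := hlim.sub_tendsto (hC.const_smul γ)
  have e : ∀ u, u - γ • C (JC u) = JC u := fun u => sub_eq_of_eq_add (S.JC_spec u).symm
  rw [← hCa] at h1
  simpa only [e] using h1

theorem exists_linear_rate (S : StepSetting A C T JA JC ρ r β κ γ) (hr : 0 < r)
    {T' : ℕ → H → H} {ω : ℕ → ℝ} {z : ℕ → H} (hω : ∀ n, 0 ≤ ω n) (hs : Summable ω)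
    (hT' : ∀ xb, ∃ c, 0 ≤ c ∧ ∀ n x, ‖T' n x - T x‖ ≤ ω n * (c * (1 + ‖x - xb‖)))
    (hz : ∀ n, z (n + 1) = step JA JC (T' n) γ (z n)) {zb : H}
    (hzb : -(C (JC zb) + T (JC zb)) ∈ A (JC zb)) {η : ℝ} (hη0 : 0 ≤ η) (hη1 : η < 1)
    (hη : ∀ n, ω n = ω 0 * η ^ n) : ConvergesLinearly z zb := by
  obtain ⟨Q, hQ, herr⟩ := S.exists_step_error_bound hω hs hT' hz hzb
  obtain ⟨θ, hθ0, hθ1, hθ⟩ := S.exists_contraction hr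
  refine exists_geometric_bound (fun n => norm_nonneg (z n - zb)) hθ0 hθ1 hη0 hη1
    (mul_nonneg (hω 0) hQ) fun n => ?_
  have h1 := norm_sub_le_norm_sub_add_norm_sub (z (n + 1)) (step JA JC T γ (z n)) zb
  have h2 := herr n
  rw [hη n] at h2
  linarith [hθ (z n) zb hzb]

theorem solution_unique (S : StepSetting A C T JA JC ρ r β κ γ) (hr : 0 < r) {x y : H}
    (hx : -(C x + T x) ∈ A x) (hy : -(C y + T y) ∈ A y) : x = y := by
  have h1 := S.AT_mono x y _ ⟨_, hx, rfl⟩ _ ⟨_, hy, rfl⟩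
  have h2 := S.C_coco x y
  have e : -(C x + T x) + T x - (-(C y + T y) + T y) = -(C x - C y) := by abel
  simp only [e, inner_neg_right] at h1
  have h3 := mul_nonneg S.β_pos.le (sq_nonneg ‖C x - C y‖)
  have h4 : ‖x - y‖ ^ 2 ≤ 0 := by
    by_contra! hcon
    nlinarith
  have h5 : ‖x - y‖ = 0 := by nlinarith [norm_nonneg (x - y), sq_nonneg ‖x - y‖]
  exact sub_eq_zero.1 (norm_eq_zero.1 h5)

end StepSetting

end Convergence

/-! ### Verification of the abstract assumptions for the mismatched inclusion. -/

section Problem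

theorem lip_nonneg {E F : Type*} [NormedAddCommGroup E] [InnerProductSpace ℝ E]
    [NormedAddCommGroup F] [InnerProductSpace ℝ F] (T : E → F) : 0 ≤ lip T :=
  Real.sInf_nonneg fun _ hb => hb.1

/-- The infimum is itself a Lipschitz constant; `b` guarantees that it is not taken over the empty
set. -/
theorem IsLipschitzian.lip {E F : Type*} [NormedAddCommGroup E] [InnerProductSpace ℝ E]
    [NormedAddCommGroup F] [InnerProductSpace ℝ F] {T : E → F} {b : ℝ} (hb : 0 ≤ b)
    (h : IsLipschitzian b T) : IsLipschitzian (lip T) T := fun x y => by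
  rcases (norm_nonneg (x - y)).eq_or_lt with h0 | h0
  · have := h x y
    rw [← h0, mul_zero] at this ⊢
    exact this
  · rw [← div_le_iff₀ h0]
    exact le_csInf ⟨b, hb, h⟩ fun c hc => (div_le_iff₀ h0).2 (hc.2 x y)

variable {H G : Type*} [NormedAddCommGroup H] [InnerProductSpace ℝ H]
  [NormedAddCommGroup G] [InnerProductSpace ℝ G]

theorem resolvent_spec {A : H → Set H} {γ : ℝ} {u : H}
    (h : ∃ p v, v ∈ A p ∧ p + γ • v = u) :
    ∃ v ∈ A (J (scale γ A) u), J (scale γ A) u + γ • v = u := by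
  obtain ⟨p, v, hv, hpv⟩ := h
  have : J (scale γ A) u ∈ resolventValues (scale γ A) u :=
    Classical.epsilon_spec (p := fun q => q ∈ resolventValues (scale γ A) u)
      ⟨p, γ • v, ⟨v, hv, rfl⟩, hpv⟩
  obtain ⟨_, ⟨v', hv', rfl⟩, h'⟩ := this
  exact ⟨v', hv', h'⟩

theorem IsRhoMonotone.existsUnique_resolvent {A : H → Set H} {ρ γ : ℝ}
    (hA : IsRhoMonotone ρ A) (hγ : 0 < γ) (hργ : 0 < 1 + ρ * γ) {u : H}
    (h : ∃ p v, v ∈ A p ∧ p + γ • v = u) : ∃! p, p ∈ resolventValues (scale γ A) u := by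
  obtain ⟨p, v, hv, hpv⟩ := h
  refine ⟨p, ⟨γ • v, ⟨v, hv, rfl⟩, hpv⟩, ?_⟩
  rintro q ⟨_, ⟨v', hv', rfl⟩, hq⟩
  have h1 := hA.norm_sub_le_of_add_smul hγ hv' hv
  simp only at hq
  rw [hq, hpv, sub_self, norm_zero] at h1
  exact sub_eq_zero.1 (norm_le_zero_iff.1 (by nlinarith [norm_nonneg (q - p)]))

theorem mem_zer_problemOp {A : H → Set H} {C : H → H} {B : G → G} {L : H →L[ℝ] G}
    {K : G →L[ℝ] H} {c : G} {α : ℝ} {x : H} :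
    x ∈ zer (problemOp A C B L K c α) ↔ -(C x + D B L c α K x) ∈ A x := by
  constructor
  · rintro ⟨_, ⟨a, ha, rfl⟩, h⟩
    have h' : a + C x + D B L c α K x = 0 := h
    rwa [← eq_neg_of_add_eq_zero_left (by rwa [add_assoc] at h')]
  · intro h
    refine ⟨_, ⟨_, h, rfl⟩, ?_⟩
    simp only
    abel

theorem isLipschitzian_comp_forward {B : G → G} {ζ : ℝ} (hB : IsLipschitzian ζ B) {α : ℝ}
    (hα : 0 ≤ α) (L : H →L[ℝ] G) (M : G →L[ℝ] H) :
    IsLipschitzian (‖M‖ * (α * ‖L‖ + |ζ| * ‖L‖)) fun x : H => M (α • L x + B (L x)) := by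
  intro x y
  have e : M (α • L x + B (L x)) - M (α • L y + B (L y))
      = M (α • L (x - y) + (B (L x) - B (L y))) := by
    rw [← map_sub, map_sub L]; congr 1; module
  have h1 : ‖B (L x) - B (L y)‖ ≤ |ζ| * (‖L‖ * ‖x - y‖) := by
    refine (hB _ _).trans (mul_le_mul (le_abs_self ζ) ?_ (norm_nonneg _) (abs_nonneg ζ))
    rw [← map_sub]
    exact L.le_opNorm _
  beta_reduce
  rw [e, mul_assoc]
  refine (M.le_opNorm _).trans (mul_le_mul_of_nonneg_left ?_ (norm_nonneg M))
  refine (norm_add_le _ _).trans ?_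
  rw [norm_smul, Real.norm_eq_abs, abs_of_nonneg hα]
  have h2 := mul_le_mul_of_nonneg_left (L.le_opNorm (x - y)) hα
  linarith

theorem isLipschitzian_D {B : G → G} {ζ : ℝ} (hB : IsLipschitzian ζ B) {α : ℝ} (hα : 0 ≤ α)
    (L : H →L[ℝ] G) (K : G →L[ℝ] H) (c : G) :
    IsLipschitzian (kappa B L α K) (D B L c α K) := by
  intro x y
  have h := (isLipschitzian_comp_forward hB hα L K).lip (by positivity) x y
  have e : D B L c α K x - D B L c α K y
      = K (α • L x + B (L x)) - K (α • L y + B (L y)) := by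
    simp only [D, map_add, map_sub, map_smul]; module
  rw [e]
  exact h

theorem lambdaMin_mul_le (L : H →L[ℝ] G) (K : G →L[ℝ] H) (d : H) :
    lambdaMin L K * ‖d‖ ^ 2 ≤ inner ℝ d (K (L d)) := by
  rcases eq_or_ne d 0 with rfl | hd
  · simp
  have hd0 : 0 < ‖d‖ := norm_pos_iff.2 hd
  -- Without a lower bound `sInf` would take its default value 0.
  have hbdd : BddBelow {r : ℝ | ∃ x : H, ‖x‖ = 1 ∧ r = inner ℝ x (K (L x))} := by
    refine ⟨-‖K ∘L L‖, ?_⟩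
    rintro _ ⟨x, hx, rfl⟩
    have h1 := neg_le_of_abs_le (abs_real_inner_le_norm x (K (L x)))
    have h2 := (K ∘L L).le_opNorm x
    rw [hx, mul_one] at h2
    rw [hx, one_mul] at h1
    exact (neg_le_neg h2).trans h1
  have h := csInf_le hbdd ⟨‖d‖⁻¹ • d, by
    rw [norm_smul, norm_inv, norm_norm, inv_mul_cancel₀ hd0.ne'], rfl⟩
  rw [map_smul, map_smul, real_inner_smul_left, real_inner_smul_right] at h
  calc lambdaMin L K * ‖d‖ ^ 2
      ≤ (‖d‖⁻¹ * (‖d‖⁻¹ * inner ℝ d (K (L d)))) * ‖d‖ ^ 2 :=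
        mul_le_mul_of_nonneg_right h (sq_nonneg _)
    _ = _ := by field_simp

/-- Splitting K = L* - (L* - K) in the B term gives ⟪Lx - Ly, BLx - BLy⟫ ≥ 0 minus a mismatch
controlled by its Lipschitz constant; the linear term contributes α λ_min. -/
theorem isRhoMonotone_add_D [CompleteSpace H] [CompleteSpace G] {A : H → Set H} {ρ : ℝ}
    (hA : IsRhoMonotone ρ A) {B : G → G} (hBm : IsMonotone B) {ζ : ℝ}
    (hB : IsLipschitzian ζ B) {α : ℝ} (hα : 0 ≤ α) (L : H →L[ℝ] G) (K : G →L[ℝ] H) (c : G) :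
    IsRhoMonotone (rhoHat ρ B L K α) (addSingle A (D B L c α K)) := by
  rintro x y _ ⟨a, ha, rfl⟩ _ ⟨b, hb, rfl⟩
  have h1 := hA x y a ha b hb
  have h2 := mul_le_mul_of_nonneg_left (lambdaMin_mul_le L K (x - y)) hα
  have h3 := hBm (L x) (L y)
  have h4 : IsLipschitzian (zetaTilde B L (ContinuousLinearMap.adjoint L - K))
      fun x : H => (ContinuousLinearMap.adjoint L - K) (B (L x)) := by
    refine IsLipschitzian.lip (b := ‖ContinuousLinearMap.adjoint L - K‖ * (0 * ‖L‖ + |ζ| * ‖L‖))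
      (by positivity) ?_
    simpa only [zero_smul, zero_add] using
      isLipschitzian_comp_forward hB le_rfl L (ContinuousLinearMap.adjoint L - K)
  have h5 := (real_inner_le_norm (x - y) _).trans
    (mul_le_mul_of_nonneg_left (h4 x y) (norm_nonneg (x - y)))
  have e : a + D B L c α K x - (b + D B L c α K y)
      = (a - b) + α • K (L (x - y)) + ContinuousLinearMap.adjoint L (B (L x) - B (L y))
        - ((ContinuousLinearMap.adjoint L - K) (B (L x))
          - (ContinuousLinearMap.adjoint L - K) (B (L y))) := by
    simp only [D, map_sub, _root_.sub_apply]; module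
  beta_reduce
  rw [e, inner_sub_right, inner_add_right, inner_add_right, real_inner_smul_right,
    ContinuousLinearMap.adjoint_inner_right, map_sub L]
  rw [map_sub L] at h2
  unfold rhoHat
  linarith

/-- The difference is `Kn n - K` applied to a map of affine growth around `xb`, so the constant does
not depend on n. -/
theorem norm_D_sub_D_le {B : G → G} {ζ : ℝ} (hB : IsLipschitzian ζ B) {α : ℝ} (hα : 0 ≤ α)
    (L : H →L[ℝ] G) (K : G →L[ℝ] H) (c : G) {Kn : ℕ → G →L[ℝ] H} {ω : ℕ → ℝ}
    (hKn : ∀ n, ‖Kn n - K‖ ≤ ω n) (xb : H) :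
    ∃ b, 0 ≤ b ∧ ∀ n x, ‖D B L c α (Kn n) x - D B L c α K x‖
      ≤ ω n * (b * (1 + ‖x - xb‖)) := by
  refine ⟨‖α • (L xb - c) + B (L xb)‖ + (α * ‖L‖ + |ζ| * ‖L‖), by positivity, fun n x => ?_⟩
  have e : D B L c α (Kn n) x - D B L c α K x
      = (Kn n - K) ((α • (L xb - c) + B (L xb)) + (α • L (x - xb) + (B (L x) - B (L xb)))) := by
    simp only [D, map_add, map_sub, map_smul, _root_.sub_apply]; module
  have h1 : ‖B (L x) - B (L xb)‖ ≤ |ζ| * (‖L‖ * ‖x - xb‖) := by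
    refine (hB _ _).trans (mul_le_mul (le_abs_self ζ) ?_ (norm_nonneg _) (abs_nonneg ζ))
    rw [← map_sub]
    exact L.le_opNorm _
  have h2 : ‖α • L (x - xb)‖ ≤ α * (‖L‖ * ‖x - xb‖) := by
    rw [norm_smul, Real.norm_eq_abs, abs_of_nonneg hα]
    exact mul_le_mul_of_nonneg_left (L.le_opNorm _) hα
  have h3 := norm_add_le (α • (L xb - c) + B (L xb)) (α • L (x - xb) + (B (L x) - B (L xb)))
  have h4 := norm_add_le (α • L (x - xb)) (B (L x) - B (L xb))
  rw [e]
  refine ((Kn n - K).le_opNorm _).trans (mul_le_mul (hKn n) ?_ (norm_nonneg _)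
    ((norm_nonneg _).trans (hKn n)))
  have h5 : 0 ≤ ‖α • (L xb - c) + B (L xb)‖ * ‖x - xb‖ := by positivity
  have h6 : 0 ≤ α * ‖L‖ + |ζ| * ‖L‖ := by positivity
  linarith

end Problem

end FDRF

/-! ### Assembly of the main theorem. -/

theorem mainTheorem2 {H G : Type*}
    [NormedAddCommGroup H] [InnerProductSpace ℝ H] [CompleteSpace H]
    [NormedAddCommGroup G] [InnerProductSpace ℝ G] [CompleteSpace G]
    -- data of the inclusion
    (A : H → Set H) (ρ : ℝ) (hA : FDRF.IsMaximallyRhoMonotone ρ A)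
    (C : H → H) (β : ℝ) (hβ : 0 < β) (hC : FDRF.IsCocoercive β C)
    (B : G → G) (hBmono : FDRF.IsMonotone B)
    (ζ : ℝ) (hζ : 0 < ζ) (hBlip : FDRF.IsLipschitzian ζ B)
    (L : H →L[ℝ] G) (K : G →L[ℝ] H) (c : G) (α : ℝ) (hα : 0 ≤ α)
    (hsol : (FDRF.zer (FDRF.problemOp A C B L K c α)).Nonempty)
    -- standing assumptions
    (hDK : FDRF.D B L c α K ≠ 0)
    (hρhat : 0 ≤ FDRF.rhoHat ρ B L K α)
    (Kn : ℕ → G →L[ℝ] H) (ω : ℕ → ℝ) (hω : ∀ n, 0 ≤ ω n) (hωsum : Summable ω)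
    (hKn : ∀ n, ‖Kn n - K‖ ≤ ω n)
    -- step size and iterates
    (γ : ℝ) (hγ : γ ∈ FDRF.Gam ρ β B L K α)
    (x w y z : ℕ → H) (hiter : FDRF.IsIteration A C B L Kn c α γ x w y z) :
    -- the resolvents used by the iteration are single-valued and everywhere defined
    (∀ u : H, ∃! p : H, p ∈ FDRF.resolventValues (FDRF.scale γ A) u) ∧
    (∀ u : H, ∃! p : H, p ∈ FDRF.resolventValues (FDRF.scale γ (FDRF.single C)) u) ∧
    ∃ zbar ∈ Function.fixedPoints (FDRF.V A C B L K c α γ),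
      (FDRF.ConvergesWeakly z zbar ∧
        FDRF.ConvergesWeakly x (FDRF.J (FDRF.scale γ (FDRF.single C)) zbar) ∧
        FDRF.J (FDRF.scale γ (FDRF.single C)) zbar ∈
          FDRF.zer (FDRF.problemOp A C B L K c α)) ∧
      (0 < FDRF.rhoHat ρ B L K α →
        (∃ η : ℝ, 0 ≤ η ∧ η < 1 ∧ ∀ n, ω n = ω 0 * η ^ n) →
        FDRF.ConvergesLinearly z zbar ∧
        FDRF.ConvergesLinearly x (FDRF.J (FDRF.scale γ (FDRF.single C)) zbar) ∧
        FDRF.zer (FDRF.problemOp A C B L K c α) =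
          {FDRF.J (FDRF.scale γ (FDRF.single C)) zbar}) := by

  obtain ⟨hγ0, hγ1, hγ2⟩ := hγ
  have hρ : 0 < 1 + ρ * γ := by linarith
  have hexA := fun u => hA.exists_mem_resolventValues hγ0 hγ2 u
  have hexC : ∀ u, ∃ p v, v ∈ FDRF.single C p ∧ p + γ • v = u := fun u => by
    obtain ⟨p, hp⟩ := hC.exists_add_smul_eq hβ hγ0 u
    exact ⟨p, C p, rfl, hp⟩
  have S : FDRF.StepSetting A C (FDRF.D B L c α K) (FDRF.J (FDRF.scale γ A))
      (FDRF.J (FDRF.scale γ (FDRF.single C))) ρ (FDRF.rhoHat ρ B L K α) β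
      (FDRF.kappa B L α K) γ :=
    { β_pos := hβ
      γ_pos := hγ0
      κ_nonneg := FDRF.lip_nonneg _
      r_nonneg := hρhat
      gap_pos := by linarith
      ρ_lt := hρ
      A_mono := hA.1
      C_coco := hC
      T_lip := FDRF.isLipschitzian_D hBlip hα L K c
      AT_mono := FDRF.isRhoMonotone_add_D hA.1 hBmono hBlip hα L K c
      JA_spec := fun u => FDRF.resolvent_spec (hexA u)
      JC_spec := fun u => by
        obtain ⟨v, hv, h⟩ := FDRF.resolvent_spec (hexC u)
        rw [Set.mem_singleton_iff.1 hv] at h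
        exact h }
  have hz : ∀ n, z (n + 1) = FDRF.step (FDRF.J (FDRF.scale γ A))
      (FDRF.J (FDRF.scale γ (FDRF.single C))) (FDRF.D B L c α (Kn n)) γ (z n) := fun n => by
    rw [hiter.z_eq, hiter.y_eq, hiter.w_eq, hiter.x_eq]
    unfold FDRF.step FDRF.stepMid
    module
  have hT' := FDRF.norm_D_sub_D_le hBlip hα L K c hKn
  obtain ⟨x₀, hx₀⟩ := hsol
  rw [FDRF.mem_zer_problemOp] at hx₀
  have hJx₀ := S.JC_eq (x := x₀) rfl
  -- A solution x₀ lifts to x₀ + γCx₀, whose resolvent J_{γC} is x₀.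
  obtain ⟨zbar, hmid, hzbar, hzlim, hxlim⟩ := S.exists_weakLim hω hωsum hT' hz
    (zb := x₀ + γ • C x₀) (by rw [hJx₀]; exact hx₀)
  have hx : x = fun n => FDRF.J (FDRF.scale γ (FDRF.single C)) (z n) := funext hiter.x_eq
  have hzer := FDRF.mem_zer_problemOp.2 hzbar
  refine ⟨fun u => hA.1.existsUnique_resolvent hγ0 hρ (hexA u),
    fun u => (hC.isRhoMonotone_single hβ.le).existsUnique_resolvent hγ0 (by linarith) (hexC u),
    zbar, ?_, ⟨hzlim.convergesWeakly, ?_, hzer⟩, ?_⟩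
  -- V^γ is the exact step by definition. At `zbar` the midpoint equals the resolvent, so the two
  -- forward terms cancel.
  · change FDRF.step _ _ _ γ zbar = zbar
    unfold FDRF.step
    rw [hmid]
    abel
  · rw [hx]
    exact hxlim.convergesWeakly
  · rintro hr ⟨η, hη0, hη1, hη⟩
    have hlin := S.exists_linear_rate hr hω hωsum hT' hz hzbar hη0 hη1 hη
    refine ⟨hlin, ?_, ?_⟩
    · obtain ⟨M, q, hq0, hq1, hM⟩ := hlin
      refine ⟨M, q, hq0, hq1, fun n => ?_⟩
      rw [hx]
      exact (S.JC_norm_sub_le _ _).trans (hM n)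
    · ext y
      rw [Set.mem_singleton_iff]
      constructor
      · intro hy
        exact S.solution_unique hr (FDRF.mem_zer_problemOp.1 hy) hzbar
      · rintro rfl
        exact hzer
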